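/- Let $X$ be a quasi-compact separated scheme and let $\pi\colon\mathbb A^1_X\to X$ be its affine line, with coordinate function $T\in\Gamma(\mathbb A^1_X,\mathcal O)$. Write $\mathrm{Qcoh}(Y)$ for the category of quasi-coherent $\mathcal O_Y$-modules on a scheme $Y$. Let $\mathcal L$ be the loop category: it has one object $\bullet$, and the endomorphism monoid of $\bullet$ is $(\mathbb N,+)$. For categories $\mathcal C$ and $I$, write $\mathcal C^I$ for the category of functors $I\to\mathcal C$. (1) For every quasi-coherent module $M$ on $\mathbb A^1_X$ the module $\pi_*M$ is quasi-coherent, and the functor $$e\colon \mathrm{Qcoh}(\mathbb A^1_X)\longrightarrow \mathrm{Qcoh}(X)^{\mathcal L},\qquad M\longmapsto\bigl(\bullet\mapsto \pi_*M,\ n\mapsto (T^n\cdot-)\bigr)$$ is an equivalence of categories. (2) For a scheme $Y$ let $\mathbb D_Y$ be the prederivator $\mathbb D_Y(I)=D(\mathrm{Qcoh}(Y)^I)$; it is a strict 2-functor from small categories to categories that reverses the direction of functors and keeps the direction of natural transformations. Here $D(\mathcal A)=\mathrm{Ch}(\mathcal A)[\{\text{quasi-isomorphisms}\}^{-1}]$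 is the (unbounded) derived category of an abelian category $\mathcal A$, and a functor $u\colon I\to J$ acts by restriction along $u$. Let $(\mathbb D_X)^{\mathcal L}$ be the shifted prederivator $I\mapsto \mathbb D_X(\mathcal L\times I)$. Then there is a strong equivalence of derivators $$\mathbb D_{\mathbb A^1_X}\;\simeq\;(\mathbb D_X)^{\mathcal L},$$ that is, there are strict 2-natural transformations in both directions whose two composites are isomorphic to the identities by invertible modifications. It is induced by $e$: for every small category $I$, its component $D(\mathrm{Qcoh}(\mathbb A^1_X)^I)\to D(\mathrm{Qcoh}(X)^{\mathcal L\times I})$, composed with the localization functor from complexes, equals the functor that applies the functor $\mathrm{Qcoh}(\mathbb A^1_X)^I\to \mathrm{Qcoh}(X)^{\mathcal L\times I}$, $F\mapsto\bigl((\bullet,i)\mapsto e(F(i))(\bullet)\bigr)$, degreewise to complexes, followed by localization. -/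

import Mathlib

universe u v w

open CategoryTheory Limits Opposite

/-! ## Quasi-coherent sheaves form an abelian category -/

open AlgebraicGeometry

namespace AlgebraicGeometry.Scheme

open TopologicalSpace
open scoped ZeroObject

/-- The property of being a quasi-coherent `𝒪_X`-module. -/
abbrev isQcoh (X : Scheme.{u}) : ObjectProperty X.Modules :=
  fun M ↦ SheafOfModules.IsQuasicoherent (R := X.ringCatSheaf) M

/-- The category `Qcoh(X)`: the full subcategory of quasi-coherent `𝒪_X`-modules. -/
abbrev Qcoh (X : Scheme.{u}) : Type (u + 1) := X.isQcoh.FullSubcategory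

variable {X : Scheme.{u}}




lemma Modules.isQuasicoherent_of_cover (M : X.Modules)
    (h : ∀ x : X, ∃ U : X.Opens, x ∈ U ∧ Nonempty (M.restrict U.ι).Presentation) :
    M.IsQuasicoherent := by
  choose U hU P using h
  let D : SheafOfModules.QuasicoherentData.{u, u, u, u} M := by
    refine SheafOfModules.QuasicoherentData.mk (R := X.ringCatSheaf) (M := M) X U ?_ fun x ↦ ?_
    · rw [Opens.coversTop_iff]
      exact top_le_iff.mp fun x _ ↦ Opens.mem_iSup.mpr ⟨x, hU x⟩
    · have e := (Modules.overFunctorEquiv (U x)).app M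
      have e1 : (Modules.overEquiv (U x)).functor.obj (SheafOfModules.unit _) ≅ SheafOfModules.unit _ := 
        (Modules.overFunctorEquiv (U x)).app (SheafOfModules.unit _) ≪≫ Modules.restrictUnitIso _
      have e2 := (Modules.overEquiv (U x)).unitIso.app (SheafOfModules.unit _) ≪≫ (Modules.overEquiv (U x)).inverse.mapIso e1
      have e3 := (Modules.overEquiv (U x)).inverse.mapIso e.symm ≪≫ (Modules.overEquiv (U x)).unitIso.symm.app _
      have i1 : PreservesColimitsOfSize.{u, u} (Modules.overEquiv (U x)).inverse := inferInstance
      let F : SheafOfModules.{u} (U x).toScheme.ringCatSheaf ⥤ SheafOfModules.{u} (X.ringCatSheaf.over (U x)) :=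
        (Modules.overEquiv (U x)).inverse
      have i2 : PreservesColimitsOfSize.{u, u} F := i1
      exact SheafOfModules.Presentation.ofIsIso.{u,u,u} e3.hom ((P x).some.map F e2)
  exact D.isQuasicoherent


lemma Modules.kernel_sections {K M N : X.Modules} (i : K ⟶ M) (g : M ⟶ N) (w : i ≫ g = 0)
    (h : IsLimit (KernelFork.ofι i w)) (U : X.Opens) :
    Function.Injective (i.app U) ∧ ∀ x, g.app U x = 0 → ∃ y, i.app U y = x := by
  let S : ShortComplex X.Modules := ⟨i, g, w⟩
  have hS : S.Exact := S.exact_of_f_is_kernel h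
  have : Mono S.f := Fork.IsLimit.mono h
  let F : X.Modules ⥤ Ab.{u} := Modules.toPresheaf X ⋙ (CategoryTheory.evaluation _ _).obj (op U)
  have : PreservesLimits (Modules.toPresheaf X) := inferInstance
  have : PreservesLimits ((CategoryTheory.evaluation (Opens X)ᵒᵖ Ab.{u}).obj (op U)) :=
    ⟨inferInstance⟩
  have : PreservesLimits F := comp_preservesLimits _ _
  have : F.PreservesZeroMorphisms := ⟨fun _ _ ↦ rfl⟩
  have h1 := hS.map_of_mono_of_preservesKernel F inferInstance inferInstance
  rw [ShortComplex.ab_exact_iff] at h1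
  have h2 : Mono (F.map S.f) := inferInstance
  exact ⟨(AddCommGrpCat.mono_iff_injective _).1 h2, h1⟩

lemma Modules.isQuasicoherent_of_sectionwise_kernel {R : CommRingCat.{u}}
    {K M N : (Spec R).Modules} (i : K ⟶ M) (g : M ⟶ N) (w : i ≫ g = 0)
    (h : ∀ U, Function.Injective (i.app U) ∧ ∀ x, g.app U x = 0 → ∃ y, i.app U y = x)
    [hM : M.IsQuasicoherent] [hN : N.IsQuasicoherent] : K.IsQuasicoherent := by
  rw [isQuasicoherent_iff_isIso_fromTildeΓ, isIso_fromTildeΓ_iff_isLocalizing] at hM hN ⊢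
  intro f
  let V : (Spec R).Opens := PrimeSpectrum.basicOpen f
  let r (L : (Spec R).Modules) :
      Γ(L, ⊤) →ₗ[R] Γ(L, V) := ((modulesSpecToSheaf.obj L).obj.map V.leTop.op).hom
  have hrM : IsLocalizedModule.Away f (r M) := hM f
  have hrN : IsLocalizedModule.Away f (r N) := hN f
  let iT : Γ(K, ⊤) →ₗ[R] Γ(M, ⊤) := ((modulesSpecToSheaf.map i).hom.app (op ⊤)).hom
  let iV : Γ(K, V) →ₗ[R] Γ(M, V) := ((modulesSpecToSheaf.map i).hom.app (op V)).hom
  let gT : Γ(M, ⊤) →ₗ[R] Γ(N, ⊤) := ((modulesSpecToSheaf.map g).hom.app (op ⊤)).hom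
  let gV : Γ(M, V) →ₗ[R] Γ(N, V) := ((modulesSpecToSheaf.map g).hom.app (op V)).hom
  have hiT : Function.Injective iT := (h ⊤).1
  have hiV : Function.Injective iV := (h V).1
  have hgT : ∀ x, gT x = 0 → ∃ y, iT y = x := (h ⊤).2
  have hw : ∀ x, gV (iV x) = 0 := fun x ↦ by
    have := congr(Hom.app $w V x)
    exact this
  have ni : ∀ x, r M (iT x) = iV (r K x) := fun x ↦
    (congr($((modulesSpecToSheaf.map i).hom.naturality V.leTop.op).hom x)).symm
  have ng : ∀ x, r N (gT x) = gV (r M x) := fun x ↦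
    (congr($((modulesSpecToSheaf.map g).hom.naturality V.leTop.op).hom x)).symm
  change IsLocalizedModule.Away f (r K)
  refine IsLocalizedModule.Away.mk_of_addCommGroup ?_ ?_ ?_
  · exact Scheme.Modules.isUnit_algebraMap_end_of_le_basicOpen f le_rfl
  · intro x
    obtain ⟨⟨t, ⟨_, n, rfl⟩⟩, ht⟩ := IsLocalizedModule.surj (.powers f) (r M) (iV x)
    change f ^ n • iV x = r M t at ht
    have h0 : r N (gT t) = 0 := by rw [ng, ← ht, LinearMap.map_smul, hw, smul_zero]
    obtain ⟨⟨_, m, rfl⟩, hm⟩ := (IsLocalizedModule.eq_zero_iff (.powers f) (r N)).mp h0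
    change f ^ m • gT t = 0 at hm
    obtain ⟨y, hy⟩ := hgT (f ^ m • t) (by rw [LinearMap.map_smul, hm])
    refine ⟨m + n, y, hiV ?_⟩
    rw [← ni, hy, LinearMap.map_smul, LinearMap.map_smul, ← ht, smul_smul, pow_add]
  · intro x hx
    have h0 : r M (iT x) = 0 := by rw [ni, hx, map_zero]
    obtain ⟨⟨_, m, rfl⟩, hm⟩ := (IsLocalizedModule.eq_zero_iff (.powers f) (r M)).mp h0
    change f ^ m • iT x = 0 at hm
    exact ⟨m, hiT (by rw [LinearMap.map_smul, hm, map_zero])⟩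

lemma Modules.nonempty_presentation {R : CommRingCat.{u}} (M : (Spec R).Modules)
    [hM : M.IsQuasicoherent] : Nonempty M.Presentation :=
  have h : IsIso M.fromTildeΓ := isIso_fromTildeΓ_of_isQuasicoherent M
  have : @IsIso (SheafOfModules.{u} (Spec R).ringCatSheaf) _ _ _ M.fromTildeΓ := h
  ⟨SheafOfModules.Presentation.ofIsIso.{u, u, u} M.fromTildeΓ
    (presentationTilde.{u} _ .univ (by simp) _ (Submodule.span_eq _))⟩

lemma Modules.isQuasicoherent_iff_affine (M : X.Modules) :
    M.IsQuasicoherent ↔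
      ∀ (U : X.Opens) (hU : IsAffineOpen U), (M.restrict hU.fromSpec).IsQuasicoherent := by
  refine ⟨fun _ U hU ↦ inferInstance, fun h ↦ M.isQuasicoherent_of_cover fun x ↦ ?_⟩
  obtain ⟨U, hU, hx, -⟩ := exists_isAffineOpen_mem_and_subset (x := x) (U := ⊤) trivial
  have := h U hU
  obtain ⟨P⟩ := (M.restrict hU.fromSpec).nonempty_presentation
  refine ⟨U, hx, ⟨?_⟩⟩
  let e : (M.restrict hU.fromSpec).restrict hU.isoSpec.hom ≅ M.restrict U.ι :=
    ((restrictFunctorComp _ _).symm ≪≫ restrictFunctorCongr hU.isoSpec_hom_fromSpec).app M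
  have h : IsIso e.hom := inferInstance
  have : @IsIso (SheafOfModules.{u} U.toScheme.ringCatSheaf) _ _ _ e.hom := h
  exact SheafOfModules.Presentation.ofIsIso.{u, u, u} e.hom (presentationRestrict hU.isoSpec.hom P)

instance : X.isQcoh.IsClosedUnderIsomorphisms :=
  inferInstanceAs (SheafOfModules.isQuasicoherent X.ringCatSheaf).IsClosedUnderIsomorphisms

lemma Modules.isQuasicoherent_tilde_iff {R : CommRingCat.{u}} (M : (Spec R).Modules) :
    M.IsQuasicoherent ↔ (tilde.functor R).essImage M := by
  rw [isQuasicoherent_iff_isIso_fromTildeΓ, isIso_fromTildeΓ_iff]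

lemma Modules.isQuasicoherent_cokernel {R : CommRingCat.{u}} {M N : (Spec R).Modules} (g : M ⟶ N)
    [hM : M.IsQuasicoherent] [hN : N.IsQuasicoherent] : (cokernel g).IsQuasicoherent := by
  rw [isQuasicoherent_tilde_iff] at hM hN ⊢
  obtain ⟨A, ⟨a⟩⟩ := hM
  obtain ⟨B, ⟨b⟩⟩ := hN
  let f := (tilde.functor R).preimage (a.hom ≫ g ≫ b.inv)
  exact ⟨cokernel f, ⟨PreservesCokernel.iso (tilde.functor R) f ≪≫
    cokernel.mapIso _ _ a b (by rw [(tilde.functor R).map_preimage]; simp)⟩⟩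

lemma Modules.isQuasicoherent_biprod {R : CommRingCat.{u}} {M N : (Spec R).Modules}
    [hM : M.IsQuasicoherent] [hN : N.IsQuasicoherent] : (M ⊞ N).IsQuasicoherent := by
  rw [isQuasicoherent_tilde_iff] at hM hN ⊢
  obtain ⟨A, ⟨a⟩⟩ := hM
  obtain ⟨B, ⟨b⟩⟩ := hN
  have : PreservesBinaryBiproduct A B (tilde.functor R) :=
    preservesBinaryBiproduct_of_preservesBinaryCoproduct _
  exact ⟨A ⊞ B, ⟨(tilde.functor R).mapBiprod A B ≪≫ biprod.mapIso a b⟩⟩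

lemma Modules.isQuasicoherent_cokernel' {M N : X.Modules} (g : M ⟶ N)
    [hM : M.IsQuasicoherent] [hN : N.IsQuasicoherent] : (cokernel g).IsQuasicoherent := by
  rw [isQuasicoherent_iff_affine]
  intro U hU
  have h : (cokernel ((restrictFunctor hU.fromSpec).map g)).IsQuasicoherent :=
    isQuasicoherent_cokernel _
  exact (isQcoh _).prop_of_iso (PreservesCokernel.iso (restrictFunctor hU.fromSpec) g).symm h

lemma Modules.isQuasicoherent_biprod' {M N : X.Modules}
    [hM : M.IsQuasicoherent] [hN : N.IsQuasicoherent] : (M ⊞ N).IsQuasicoherent := by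
  rw [isQuasicoherent_iff_affine]
  intro U hU
  have : (restrictFunctor hU.fromSpec).PreservesZeroMorphisms := inferInstance
  have : PreservesBinaryBiproduct M N (restrictFunctor hU.fromSpec) :=
    preservesBinaryBiproduct_of_preservesBinaryCoproduct _
  have h : (M.restrict hU.fromSpec ⊞ N.restrict hU.fromSpec).IsQuasicoherent :=
    isQuasicoherent_biprod
  exact (isQcoh _).prop_of_iso ((restrictFunctor hU.fromSpec).mapBiprod M N).symm h

lemma Modules.isQuasicoherent_of_kernel {K M N : X.Modules} (i : K ⟶ M) (g : M ⟶ N)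
    (w : i ≫ g = 0) (h : IsLimit (KernelFork.ofι i w))
    [hM : M.IsQuasicoherent] [hN : N.IsQuasicoherent] : K.IsQuasicoherent := by
  rw [isQuasicoherent_iff_affine]
  intro U hU
  refine isQuasicoherent_of_sectionwise_kernel ((restrictFunctor hU.fromSpec).map i)
    ((restrictFunctor hU.fromSpec).map g) (by rw [← Functor.map_comp, w, Functor.map_zero])
    fun V ↦ ?_
  exact kernel_sections i g w h (hU.fromSpec ''ᵁ V)

instance : X.isQcoh.IsClosedUnderKernels where
  kernels_le := by
    rintro _ ⟨f, k, hk, ⟨hM, hN⟩⟩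
    exact Modules.isQuasicoherent_of_kernel k.ι f k.condition (hM := hM) (hN := hN)
      (hk.ofIsoLimit (Fork.ext (Iso.refl _) (by simp)))

instance : X.isQcoh.IsClosedUnderCokernels where
  cokernels_le := by
    rintro _ ⟨f, k, hk, ⟨hM, hN⟩⟩
    exact X.isQcoh.prop_of_iso ((cokernelIsCokernel f).coconePointUniqueUpToIso hk)
      (Modules.isQuasicoherent_cokernel' f (hM := hM) (hN := hN))

instance : X.isQcoh.ContainsZero where
  exists_zero := by
    refine ⟨0, isZero_zero _, (Modules.isQuasicoherent_iff_affine _).2 fun U hU ↦ ?_⟩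
    rw [Modules.isQuasicoherent_tilde_iff]
    exact ⟨0, ⟨((tilde.functor _).map_isZero (isZero_zero _)).iso
      ((Modules.restrictFunctor hU.fromSpec).map_isZero (isZero_zero _))⟩⟩

instance : X.isQcoh.IsClosedUnderFiniteProducts := by
  have : X.isQcoh.IsClosedUnderBinaryProducts := ⟨by
    rintro M ⟨p⟩
    exact X.isQcoh.prop_of_iso (IsLimit.conePointsIsoOfNatIso
      (BinaryBiproduct.isLimit _ _) p.isLimit (diagramIsoPair p.diag).symm)
      (Modules.isQuasicoherent_biprod' (hM := p.prop_diag_obj _) (hN := p.prop_diag_obj _))⟩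
  exact .mk'

/-- `Qcoh(X)` is abelian, as a full subcategory of `𝒪_X`-modules closed under kernels, cokernels
and finite products. -/
noncomputable instance : Abelian X.Qcoh := inferInstance

end AlgebraicGeometry.Scheme

/-! ## The loop category and the affine line -/

/-- The loop category: one object, whose endomorphism monoid is `(ℕ, +)`. -/
def Loop : Type u := PUnit.{u + 1}

instance : SmallCategory Loop.{u} where
  Hom _ _ := ULift.{u} ℕ
  id _ := ⟨0⟩
  comp m n := ⟨m.down + n.down⟩
  id_comp _ := ULift.ext _ _ (Nat.zero_add _)
  comp_id _ := ULift.ext _ _ (Nat.add_zero _)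
  assoc _ _ _ := ULift.ext _ _ (Nat.add_assoc _ _ _)

namespace AlgebraicGeometry.Scheme

noncomputable section
variable {X : Scheme.{u}}

/-- Multiplication by a global function `r`, as an endomorphism of an `𝒪_X`-module. -/
def Modules.mulBy (M : X.Modules) (r : Γ(X, ⊤)) : M ⟶ M where
  val := PresheafOfModules.homMk
    { app U := M.smul (X.presheaf.map (homOfLE le_top : U.unop ⟶ ⊤).op r)
      naturality U V i := by
        have := Modules.map_comp_smul (M := M) i.unop (X.presheaf.map (homOfLE le_top : U.unop ⟶ ⊤).op r)
        rw [← CategoryTheory.comp_apply, ← Functor.map_comp] at this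
        exact this.symm }
    (fun U s m ↦ smul_comm (X.presheaf.map (homOfLE le_top : U.unop ⟶ ⊤).op r)
      (show Γ(X, U.unop) from s) (show Γ(M, U.unop) from m))

lemma Modules.mulBy_app (M : X.Modules) (r : Γ(X, ⊤)) (U : X.Opens) (m : Γ(M, U)) :
    (M.mulBy r).app U m = X.presheaf.map (homOfLE le_top : U ⟶ ⊤).op r • m := rfl

lemma Modules.mulBy_one (M : X.Modules) : M.mulBy 1 = 𝟙 M := by
  ext U m
  rw [mulBy_app, map_one, one_smul]; rfl

lemma Modules.mulBy_mul (M : X.Modules) (r s : Γ(X, ⊤)) :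
    M.mulBy (r * s) = M.mulBy r ≫ M.mulBy s := by
  ext U m
  rw [mulBy_app, map_mul, mul_comm, mul_smul]; rfl

lemma Modules.mulBy_naturality {M N : X.Modules} (f : M ⟶ N) (r : Γ(X, ⊤)) :
    M.mulBy r ≫ f = f ≫ N.mulBy r := by
  ext U m
  exact Hom.app_smul f _ m

variable (X) in
/-- The affine line `𝔸¹_X`. -/
abbrev affineLine : Scheme.{u} := 𝔸(PUnit.{u + 1}; X)

variable (X) in
/-- The coordinate function of the affine line. -/
def affineLine.T : Γ(X.affineLine, ⊤) := AffineSpace.coord X PUnit.unit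

variable (X) in
/-- The functor that sends an `𝒪`-module `M` on the affine line, with projection `π : 𝔸¹_X ⟶ X`,
to the `Loop`-shaped diagram `π_* M` on which `n : • ⟶ •` acts as multiplication by `T ^ n`. -/
def pushforwardLoop : X.affineLine.Modules ⥤ (Loop.{u} ⥤ X.Modules) where
  obj M :=
    { obj _ := (Modules.pushforward (X.affineLine ↘ X)).obj M
      map n := (Modules.pushforward (X.affineLine ↘ X)).map (M.mulBy (affineLine.T X ^ n.down))
      map_id _ := by
        change (Modules.pushforward (X.affineLine ↘ X)).map (M.mulBy (affineLine.T X ^ 0)) = _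
        rw [pow_zero, Modules.mulBy_one, CategoryTheory.Functor.map_id]
      map_comp m n := by
        change (Modules.pushforward (X.affineLine ↘ X)).map (M.mulBy (affineLine.T X ^ (m.down + n.down))) = _
        rw [pow_add, Modules.mulBy_mul, Functor.map_comp] }
  map f :=
    { app _ := (Modules.pushforward (X.affineLine ↘ X)).map f
      naturality _ _ n := by
        dsimp only
        rw [← Functor.map_comp, ← Functor.map_comp, Modules.mulBy_naturality] }

end
end AlgebraicGeometry.Scheme

/-! ## Prederivators -/

section

open Bicategory Bicategory.Opposite

lemma unop2_eqToHom {B : Type*} [Bicategory B] {a b : Bᵒᵖ} {f g : a ⟶ b} (h : f = g) :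
   (eqToHom h).unop2 = eqToHom (congrArg Quiver.Hom.unop h) := by
  subst h; rfl

lemma hom2_ext {B : Type*} [Bicategory B] {a b : Bᵒᵖ} {f g : a ⟶ b} {η θ : f ⟶ g}
    (h : η.unop2 = θ.unop2) : η = θ :=
  congrArg Hom2.op2' h

instance {B : Type*} [Bicategory B] [Bicategory.Strict B] : Bicategory.Strict Bᵒᵖ where
  id_comp f := by apply Quiver.Hom.unop_inj; exact Strict.comp_id f.unop
  comp_id f := by apply Quiver.Hom.unop_inj; exact Strict.id_comp f.unop
  assoc f g h := by apply Quiver.Hom.unop_inj; exact (Strict.assoc h.unop g.unop f.unop).symm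
  leftUnitor_eqToIso f := by
    ext
    apply hom2_ext
    rw [eqToIso.hom, unop2_eqToHom, bicategory_leftUnitor_hom_unop2, Strict.rightUnitor_eqToIso]; rfl
  rightUnitor_eqToIso f := by
    ext
    apply hom2_ext
    rw [eqToIso.hom, unop2_eqToHom, bicategory_rightUnitor_hom_unop2, Strict.leftUnitor_eqToIso]; rfl
  associator_eqToIso f g h := by
    ext
    apply hom2_ext
    rw [eqToIso.hom, unop2_eqToHom, bicategory_associator_hom_unop2, Strict.associator_eqToIso]; rfl

lemma hom2_eq_conj {B : Type*} [Bicategory B] {a b : Bᵒᵖ} {f f' g g' : a ⟶ b} (h : f = f')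
    (h' : g' = g) (η : f ⟶ g) (θ : f' ⟶ g')
    (H : η.unop2 = eqToHom (congrArg Quiver.Hom.unop h) ≫ θ.unop2 ≫
      eqToHom (congrArg Quiver.Hom.unop h')) :
    η = eqToHom h ≫ θ ≫ eqToHom h' := by
  subst h h'
  simp only [eqToHom_refl, Category.id_comp, Category.comp_id] at H ⊢
  exact hom2_ext H

lemma cat_hom₂_eq_conj {C D : Cat.{v, w}} {F F' G G' : C ⟶ D} (h : F = F') (h' : G' = G)
    (α : F ⟶ G) (β : F' ⟶ G')
    (H : ∀ x, HEq (α.toNatTrans.app x) (β.toNatTrans.app x)) :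
    α = eqToHom h ≫ β ≫ eqToHom h' := by
  subst h h'
  simp only [eqToHom_refl, Category.id_comp, Category.comp_id]
  ext x
  exact eq_of_heq (H x)

/-- A prederivator: a strict 2-functor from small categories to (large) categories that reverses the
direction of functors and keeps the direction of natural transformations (`ᵒᵖ` is the dual
bicategory with reversed 1-cells). -/
abbrev Prederivator := StrictPseudofunctor (Cat.{u, u})ᵒᵖ Cat.{u + 1, u + 1}

namespace Prederivator
noncomputable section

/-- The strict 2-functor `I ↦ L × I` on small categories. -/
def prodLeft (L : Cat.{u, u}) : StrictPseudofunctor (Cat.{u, u})ᵒᵖ (Cat.{u, u})ᵒᵖ :=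
  StrictPseudofunctor.mk''
    { obj I := op (Cat.of (L × I.unop))
      map F := (Functor.prod (𝟭 L) F.unop.toFunctor).toCatHom.op
      map₂ α := op2 (NatTrans.prod (𝟙 (𝟭 L)) α.unop2.toNatTrans).toCatHom₂
      map₂_id _ := by
        apply hom2_ext
        ext; rfl
      map₂_comp _ _ := by
        apply hom2_ext
        ext x
        · exact Prod.ext (Category.comp_id _).symm rfl
      map₂_whisker_left _ _ _ _ := hom2_eq_conj _ _ _ _ (cat_hom₂_eq_conj _ _ _ _ fun _ ↦ HEq.rfl)
      map₂_whisker_right _ _ := hom2_eq_conj _ _ _ _ (cat_hom₂_eq_conj _ _ _ _ fun _ ↦ HEq.rfl) }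

/-- The prederivator `D` shifted by `L`: `D^L = D ∘ (L × -)`, so that `D^L(I) = D(L × I)`. -/
def shift (D : Prederivator.{u}) (L : Cat.{u, u}) : Prederivator.{u} := (prodLeft L).comp D

section derived
variable {A : Type w} [Category.{v} A] [Abelian A] {B : Type w} [Category.{v} B] [Abelian B]

variable (A) in
/-- The derived category `D(A)`: cochain complexes localized at the quasi-isomorphisms. -/
abbrev Derived : Type (max w v) := (HomologicalComplex.quasiIso A (ComplexShape.up ℤ)).Localization

variable (A) in
/-- The localization functor `Ch(A) ⥤ D(A)`. -/
abbrev Derived.Q : CochainComplex A ℤ ⥤ Derived A :=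
  (HomologicalComplex.quasiIso A (ComplexShape.up ℤ)).Q

/-- The functor between derived categories induced by an exact functor. -/
def Derived.map (F : A ⥤ B) [F.Additive] [F.PreservesHomology] : Derived A ⥤ Derived B :=
  Localization.Construction.lift (F.mapHomologicalComplex (ComplexShape.up ℤ) ⋙ Derived.Q B)
    fun _ _ f (_ : QuasiIso f) ↦
     Localization.Construction.wIso ((F.mapHomologicalComplex (ComplexShape.up ℤ)).map f)
       (HomologicalComplex.quasiIso_map_of_preservesHomology f F) |>.isIso_hom

lemma Derived.Q_map (F : A ⥤ B) [F.Additive] [F.PreservesHomology] :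
    Derived.Q A ⋙ Derived.map F = F.mapHomologicalComplex (ComplexShape.up ℤ) ⋙ Derived.Q B :=
  Localization.Construction.fac _ _

lemma Derived.map_Q_map (F : A ⥤ B) [F.Additive] [F.PreservesHomology]
    {K L : CochainComplex A ℤ} (f : K ⟶ L) :
    (Derived.map F).map ((Derived.Q A).map f) =
      (Derived.Q B).map ((F.mapHomologicalComplex (ComplexShape.up ℤ)).map f) :=
  (Functor.congr_hom (Derived.Q_map F) f).trans
    ((Category.id_comp _).trans (Category.comp_id _))

/-- The natural transformation between derived functors induced by a natural transformation
between exact functors. -/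
def Derived.map₂ {F G : A ⥤ B} [F.Additive] [F.PreservesHomology] [G.Additive]
    [G.PreservesHomology] (α : F ⟶ G) : Derived.map F ⟶ Derived.map G :=
  Localization.Construction.natTransExtension
    (eqToHom (Derived.Q_map F) ≫
      Functor.whiskerRight (NatTrans.mapHomologicalComplex α (ComplexShape.up ℤ)) (Derived.Q B) ≫
      eqToHom (Derived.Q_map G).symm)

lemma Derived.map₂_app {F G : A ⥤ B} [F.Additive] [F.PreservesHomology] [G.Additive]
    [G.PreservesHomology] (α : F ⟶ G) (K : CochainComplex A ℤ) :
    (Derived.map₂ α).app ((Derived.Q A).obj K) =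
      (Derived.Q B).map ((NatTrans.mapHomologicalComplex α (ComplexShape.up ℤ)).app K) := by
  rw [Derived.map₂, Localization.Construction.natTransExtension_app,
    Localization.Construction.NatTransExtension.app_eq]
  simp only [NatTrans.comp_app, CategoryTheory.eqToHom_app]
  exact (Category.id_comp _).trans (Category.comp_id _)

lemma Derived.map₂_ext {F G : Derived A ⥤ Derived B} {α β : F ⟶ G}
    (h : ∀ K, α.app ((Derived.Q A).obj K) = β.app ((Derived.Q A).obj K)) : α = β := by
  ext X
  obtain ⟨K, rfl⟩ := (Localization.Construction.objEquiv _).surjective X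
  exact h K

end derived

/-- The prederivator `I ↦ D(A^I)` of an abelian category `A`, with restriction along `u : I ⥤ J`
induced by precomposition `A^J ⥤ A^I`. -/
def ofAbelian (A : Type (u + 1)) [Category.{u} A] [Abelian A] : Prederivator.{u} :=
  StrictPseudofunctor.mk''
    { obj I := Cat.of (Derived (I.unop ⥤ A))
      map F := (Derived.map ((Functor.whiskeringLeft _ _ A).obj F.unop.toFunctor)).toCatHom
      map₂ α := (Derived.map₂ ((Functor.whiskeringLeft _ _ A).map α.unop2.toNatTrans)).toCatHom₂
      map_id I := by
        ext : 1
        refine Localization.Construction.uniq _ _ ?_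
        exact Derived.Q_map _
      map_comp F G := by
        ext : 1
        refine Localization.Construction.uniq _ _ ?_
        refine (Derived.Q_map _).trans ?_
        change _ = Derived.Q _ ⋙ (Derived.map _ ⋙ Derived.map _)
        rw [← Functor.assoc, Derived.Q_map, Functor.assoc, Derived.Q_map]
        rfl
      map₂_id F := by
        ext : 1
        refine Derived.map₂_ext fun K ↦ ?_
        refine (Derived.map₂_app _ _).trans ?_
        refine (congrArg (Derived.Q (_ ⥤ A)).map ?_).trans
          (CategoryTheory.Functor.map_id (Derived.Q (_ ⥤ A)) _)
        ext n i
        exact (K.X n).map_id _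
      map₂_comp α β := by
        ext : 1
        refine Derived.map₂_ext fun K ↦ ?_
        refine (Derived.map₂_app _ _).trans ?_
        refine Eq.trans ?_ (congrArg₂ (· ≫ ·) (Derived.map₂_app _ _) (Derived.map₂_app _ _)).symm
        refine (congrArg (Derived.Q (_ ⥤ A)).map ?_).trans ((Derived.Q (_ ⥤ A)).map_comp _ _)
        ext n i
        exact (K.X n).map_comp _ _
      map₂_whisker_left F _ _ α := cat_hom₂_eq_conj _ _ _ _ fun X ↦ by
        obtain ⟨K, rfl⟩ := (Localization.Construction.objEquiv _).surjective X
        refine (heq_of_eq (Derived.map₂_app _ _)).trans ?_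
        exact (heq_of_eq (Derived.map₂_app
          (F := (Functor.whiskeringLeft _ _ A).obj _) (G := (Functor.whiskeringLeft _ _ A).obj _)
          ((Functor.whiskeringLeft _ _ A).map α.unop2.toNatTrans)
          ((((Functor.whiskeringLeft _ _ A).obj F.unop.toFunctor).mapHomologicalComplex _).obj
            K))).symm
      map₂_whisker_right α F := cat_hom₂_eq_conj _ _ _ _ fun X ↦ by
        obtain ⟨K, rfl⟩ := (Localization.Construction.objEquiv _).surjective X
        refine (heq_of_eq (Derived.map₂_app _ _)).trans ?_
        refine HEq.trans ?_ (heq_of_eq (congrArg (Derived.map ((Functor.whiskeringLeft _ _ A).obj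
          F.unop.toFunctor)).map (Derived.map₂_app
            ((Functor.whiskeringLeft _ _ A).map α.unop2.toNatTrans) K).symm))
        exact (heq_of_eq (Derived.map_Q_map ((Functor.whiskeringLeft _ _ A).obj F.unop.toFunctor)
          ((NatTrans.mapHomologicalComplex ((Functor.whiskeringLeft _ _ A).map
            α.unop2.toNatTrans) (ComplexShape.up ℤ)).app K))).symm }

open scoped Pseudofunctor.StrongTrans

/-- An equivalence of prederivators in the strict sense: strict 2-natural transformations in both
directions, whose composites are isomorphic to the identities by invertible modifications. -/
structure StrongEquivalence (D E : Prederivator.{u}) where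
  /-- The underlying equivalence in the bicategory of pseudofunctors. -/
  equiv : Bicategory.Equivalence D.toPseudofunctor E.toPseudofunctor
  /-- The naturality squares of the forward transformation commute strictly. -/
  hom_strict {I J : (Cat.{u, u})ᵒᵖ} (F : I ⟶ J) : ∃ h, equiv.hom.naturality F = eqToIso h
  /-- The naturality squares of the backward transformation commute strictly. -/
  inv_strict {I J : (Cat.{u, u})ᵒᵖ} (F : I ⟶ J) : ∃ h, equiv.inv.naturality F = eqToIso h

/-- The component at `I` of a strict equivalence of prederivators. -/
def StrongEquivalence.functor {D E : Prederivator.{u}} (Φ : StrongEquivalence D E)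
    (I : Cat.{u, u}) : D.obj (op I) ⥤ E.obj (op I) :=
  (Φ.equiv.hom.app (op I)).toFunctor

section diagrams

variable {A : Type (u + 1)} [Category.{u} A] {B : Type (u + 1)} [Category.{u} B]
  {L : Type u} [Category.{u} L]

/-- The functor `A^I ⥤ B^(L × I)` induced by `G : A ⥤ B^L`, sending `F` to
`(l, i) ↦ G (F i) l`. -/
def diagrams (G : A ⥤ (L ⥤ B)) (I : Type u) [Category.{u} I] : (I ⥤ A) ⥤ (L × I ⥤ B) :=
  (Functor.whiskeringRight I A (L ⥤ B)).obj G ⋙ flipFunctor I L B ⋙ Functor.uncurry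

instance [HasZeroMorphisms A] [HasZeroMorphisms B] (G : A ⥤ (L ⥤ B)) [G.PreservesZeroMorphisms]
    (I : Type u) [Category.{u} I] : (diagrams G I).PreservesZeroMorphisms where
  map_zero F F' := by
    ext ⟨l, i⟩
    exact congrArg (fun f ↦ NatTrans.app f l) (G.map_zero (F.obj i) (F'.obj i))

end diagrams

end

end Prederivator

end

/-- The prederivator `D_X` of a scheme, `D_X(I) = D(Qcoh(X)^I)`. -/
noncomputable def AlgebraicGeometry.Scheme.derivator (X : Scheme.{u}) : Prederivator.{u} :=
  Prederivator.ofAbelian X.Qcoh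

/-! The statement splits into a geometric half, that `e` is an equivalence, and a formal half, that
any equivalence `A ≌ B^L` of an abelian category with a diagram category induces a strong
equivalence of prederivators.

Geometric half. Call a module extended from an open `V` if it is the direct image of its restriction
to `V`. For `U` affine in `X`, maps from a quasi-coherent `M` to a module `N` extended from `π⁻¹U`
are the linear maps of sections over `π⁻¹U`. Functions there are polynomials in `T` over `Γ(X, U)`
(`affineLine.bijective_ofPolynomial`), so these are the `Γ(X, U)`-linear maps commuting with `T`,
which are the maps of loop diagrams from `π_*M` to `π_*N`. Hence `e` is fully faithful at such `N`
(`isFullyFaithfulAt_of_isExtendedFrom`). Since `X` is separated and quasi-compact, every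
quasi-coherent module on the affine line embeds in a finite sum of such `N`, and every loop diagram
embeds in the image of such a sum (`exists_hom_isExtendedFrom`, `exists_hom_pushforward`). Every
object is then a kernel of a map between good objects, and left exactness of `e` extends full
faithfulness to all objects and gives essential surjectivity (`isEquivalence_of_exists_mono`). No
gluing of modules is needed.

Formal half. The functor `F ↦ ((l, i) ↦ e (F i) l)` commutes strictly with restriction in `I`, and
so does its quasi-inverse `H ↦ (i ↦ e⁻¹ (H (-, i)))`, because slicing is strictly natural in `I`
(`slices_comp`). Both are equivalences, hence exact, and pass to derived categories degreewise; the
unit and counit of `e` give the invertible modifications. -/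

/-! ### Strict transformations and modifications between strict 2-functors. -/

section StrictTransformations

open Bicategory
open scoped Pseudofunctor.StrongTrans

universe w₁ w₂ v₁ v₂ u₁ u₂

variable {B : Type u₁} [Bicategory.{w₁, v₁} B] [Bicategory.Strict B]
  {C : Type u₂} [Bicategory.{w₂, v₂} C] [Bicategory.Strict C]

/-- A strict 2-natural transformation between strict pseudofunctors, as a strong transformation. -/
def CategoryTheory.StrictPseudofunctor.strongTransOfStrict {F G : StrictPseudofunctor B C}
    (app : ∀ a, F.obj a ⟶ G.obj a)
    (comm : ∀ {a b : B} (f : a ⟶ b), F.map f ≫ app b = app a ≫ G.map f)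
    (comm₂ : ∀ {a b : B} {f g : a ⟶ b} (η : f ⟶ g),
      F.map₂ η ▷ app b = eqToHom (comm f) ≫ app a ◁ G.map₂ η ≫ eqToHom (comm g).symm) :
    F.toPseudofunctor ⟶ G.toPseudofunctor where
  app := app
  naturality f := eqToIso (comm f)
  naturality_naturality η := by
    rw [comm₂]; simp
  -- All structural 2-cells of strict bicategories and strict 2-functors are `eqToHom`s, so both
  -- coherence axioms compare composites of `eqToHom`s.
  naturality_id a := by
    rw [F.mapId_eq_eqToIso, G.mapId_eq_eqToIso, Strict.leftUnitor_eqToIso,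
      Strict.rightUnitor_eqToIso]
    simp
  naturality_comp f g := by
    rw [F.mapComp_eq_eqToIso, G.mapComp_eq_eqToIso]
    simp only [Strict.associator_eqToIso]
    simp

/-- The naturality constraints of a strong transformation between strict 2-functors are
equalities. -/
structure CategoryTheory.Pseudofunctor.StrongTrans.IsStrict {F G : Pseudofunctor B C}
    (η : F ⟶ G) : Prop where
  naturality_eq {a b : B} (f : a ⟶ b) : ∃ h, η.naturality f = eqToIso h

open CategoryTheory.Pseudofunctor.StrongTrans

lemma CategoryTheory.Pseudofunctor.StrongTrans.isStrict_id (F : Pseudofunctor B C) :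
    IsStrict (𝟙 F) where
  naturality_eq f := by
    refine ⟨(Strict.comp_id _).trans (Strict.id_comp _).symm, ?_⟩
    change ρ_ _ ≪≫ (λ_ _).symm = _
    rw [Strict.leftUnitor_eqToIso, Strict.rightUnitor_eqToIso]
    ext; simp; rfl

lemma CategoryTheory.Pseudofunctor.StrongTrans.IsStrict.comp {F G H : Pseudofunctor B C}
    {η : F ⟶ G} {θ : G ⟶ H} (hη : IsStrict η) (hθ : IsStrict θ) : IsStrict (η ≫ θ) where
  naturality_eq f := by
    obtain ⟨h, h'⟩ := hη.naturality_eq f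
    obtain ⟨k, k'⟩ := hθ.naturality_eq f
    refine ⟨?_, ?_⟩
    · change F.map f ≫ η.app _ ≫ θ.app _ = (η.app _ ≫ θ.app _) ≫ H.map f
      rw [← Strict.assoc, h, Strict.assoc, k, Strict.assoc]
    · ext
      rw [categoryStruct_comp_naturality_hom, h', k']
      simp only [Strict.associator_eqToIso]
      simp
      repeat erw [eqToHom_trans]
      rfl

lemma CategoryTheory.Pseudofunctor.StrongTrans.IsStrict.comm {F G : Pseudofunctor B C}
    {η : F ⟶ G} (hη : IsStrict η) {a b : B} (f : a ⟶ b) :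
    F.map f ≫ η.app b = η.app a ≫ G.map f :=
  (hη.naturality_eq f).choose

lemma CategoryTheory.Pseudofunctor.StrongTrans.IsStrict.naturality_hom {F G : Pseudofunctor B C}
    {η : F ⟶ G} (hη : IsStrict η) {a b : B} (f : a ⟶ b) :
    (η.naturality f).hom = eqToHom (hη.comm f) := by
  obtain ⟨h, h'⟩ := hη.naturality_eq f
  rw [h']; rfl

/-- An invertible modification between strict transformations. -/
def CategoryTheory.Pseudofunctor.StrongTrans.isoMkOfStrict {F G : Pseudofunctor B C}
    {η θ : F ⟶ G} (hη : IsStrict η) (hθ : IsStrict θ) (app : ∀ a, η.app a ≅ θ.app a)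
    (naturality : ∀ {a b : B} (f : a ⟶ b), F.map f ◁ (app b).hom =
      eqToHom (hη.comm f) ≫ (app a).hom ▷ G.map f ≫ eqToHom (hθ.comm f).symm) :
    η ≅ θ :=
  isoMk app fun f ↦ by
    rw [naturality, hη.naturality_hom, hθ.naturality_hom]
    simp

end StrictTransformations

/-! ### Currying an equivalence `A ≌ B^L`, and its compatibility with restriction. -/

namespace Prederivator

noncomputable section

open Bicategory
open scoped Pseudofunctor.StrongTrans

section diagrams

variable {A : Type (u + 1)} [Category.{u} A] {B : Type (u + 1)} [Category.{u} B]
  {L : Type u} [Category.{u} L]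

variable {E : Type u} [Category.{u} E]

/-- The functor `B^E ⥤ A^I` induced by `G : B^L ⥤ A` and `S : I ⥤ E^L`, sending `H` to
`i ↦ G (S i ⋙ H)`. -/
def evalAlong (G : (L ⥤ B) ⥤ A) (I : Type u) [Category.{u} I] :
    (I ⥤ L ⥤ E) ⥤ ((E ⥤ B) ⥤ (I ⥤ A)) where
  obj S :=
    { obj H := S ⋙ (Functor.whiskeringRight L E B).obj H ⋙ G
      map α := Functor.whiskerLeft S
        (Functor.whiskerRight ((Functor.whiskeringRight L E B).map α) G)
      map_id _ := by
        ext i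
        exact G.map_id _
      map_comp _ _ := by
        ext i
        refine (congrArg G.map ?_).trans (G.map_comp _ _)
        rfl }
  map τ :=
    { app H := Functor.whiskerRight τ ((Functor.whiskeringRight L E B).obj H ⋙ G)
      naturality _ _ α := by
        ext i
        refine (G.map_comp _ _).symm.trans ((congrArg G.map ?_).trans (G.map_comp _ _))
        ext l
        exact (α.naturality _).symm }
  map_id _ := by
    ext H i
    refine (congrArg G.map ?_).trans (G.map_id _)
    ext l
    exact H.map_id _
  map_comp _ _ := by
    ext H i
    refine (congrArg G.map ?_).trans (G.map_comp _ _)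
    ext l
    exact H.map_comp _ _

variable (L) in
/-- The slices `L ⥤ L × I`, `l ↦ (l, i)`, as a functor of `i`. -/
def slices (I : Type u) [Category.{u} I] : I ⥤ L ⥤ L × I where
  obj i := { obj l := (l, i), map g := (g, 𝟙 i) }
  map f := { app l := (𝟙 l, f) }

-- An equality of functors rather than an isomorphism: this is the source of strictness for the
-- backward transformation.
variable (L) in
lemma slices_comp {I J : Type u} [Category.{u} I] [Category.{u} J] (F : J ⥤ I) :
    slices L J ⋙ (Functor.whiskeringRight L (L × J) (L × I)).obj (Functor.prod (𝟭 L) F) =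
      F ⋙ slices L I :=
  CategoryTheory.Functor.ext (fun j ↦ CategoryTheory.Functor.ext (fun l ↦ rfl) (fun x y g ↦ by
    change (g, F.map (𝟙 j)) = 𝟙 (x, F.obj j) ≫ (g, 𝟙 (F.obj j)) ≫ 𝟙 (y, F.obj j)
    rw [F.map_id, Category.comp_id, Category.id_comp])) (fun x y f ↦ by
      ext l : 2
      rw [NatTrans.comp_app, NatTrans.comp_app, eqToHom_app, eqToHom_app]
      change (𝟙 l, F.map f) = 𝟙 (l, F.obj x) ≫ (𝟙 l, F.map f) ≫ 𝟙 (l, F.obj y)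
      rw [Category.comp_id, Category.id_comp])

/-- The functor `B^(L × I) ⥤ A^I` induced by `G : B^L ⥤ A`, sending `H` to `i ↦ G (H (-, i))`. -/
def undiagrams (G : (L ⥤ B) ⥤ A) (I : Type u) [Category.{u} I] : (L × I ⥤ B) ⥤ (I ⥤ A) :=
  (evalAlong G I).obj (slices L I)

/-- Currying undoes uncurrying, objectwise. -/
def curryUncurryIso {I : Type u} [Category.{u} I] (K : I ⥤ L ⥤ B) (i : I) :
    K.obj i ≅ (slices L I).obj i ⋙ Functor.uncurry.obj K.flip :=
  NatIso.ofComponents (fun l ↦ Iso.refl _) (by intros; simp [slices])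

/-- `undiagrams` of the inverse is inverse to `diagrams`: the unit. -/
def diagramsUnitIso (e : A ≌ (L ⥤ B)) (I : Type u) [Category.{u} I] :
    𝟭 (I ⥤ A) ≅ diagrams e.functor I ⋙ undiagrams e.inverse I :=
  NatIso.ofComponents (fun F ↦ NatIso.ofComponents
    (fun i ↦ e.unitIso.app (F.obj i) ≪≫
      e.inverse.mapIso (curryUncurryIso (F ⋙ e.functor) i))
    (fun {i j} f ↦ by
      change F.map f ≫ e.unitIso.hom.app _ ≫ _ = (e.unitIso.hom.app _ ≫ _) ≫ e.inverse.map _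
      rw [Category.assoc]
      erw [← e.inverse.map_comp]
      refine (e.unitIso.hom.naturality_assoc (F.map f) _).trans ?_
      congr 1
      refine (e.inverse.map_comp _ _).symm.trans ?_
      congr 1
      ext l
      change (e.functor.map (F.map f)).app l ≫ 𝟙 _ =
        𝟙 _ ≫ (e.functor.obj (F.obj i)).map (𝟙 l) ≫ (e.functor.map (F.map f)).app l
      simp)) (fun {F G} α ↦ by
        ext i
        change α.app i ≫ e.unitIso.hom.app _ ≫ _ = (e.unitIso.hom.app _ ≫ _) ≫ e.inverse.map _
        rw [Category.assoc]
        erw [← e.inverse.map_comp]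
        refine (e.unitIso.hom.naturality_assoc (α.app i) _).trans ?_
        congr 1
        refine (e.inverse.map_comp _ _).symm.trans ?_
        congr 1
        ext l
        exact (Category.comp_id _).trans (Category.id_comp _).symm)

/-- `undiagrams` of the inverse is inverse to `diagrams`: the counit. -/
def diagramsCounitIso (e : A ≌ (L ⥤ B)) (I : Type u) [Category.{u} I] :
    undiagrams e.inverse I ⋙ diagrams e.functor I ≅ 𝟭 (L × I ⥤ B) :=
  NatIso.ofComponents (fun H ↦ NatIso.ofComponents
    (fun x ↦ (e.counitIso.app ((slices L I).obj x.2 ⋙ H)).app x.1)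
    (fun {x y} f ↦ by
      let K := slices L I ⋙ (Functor.whiskeringRight L _ _).obj H
      have h : (e.functor.map (e.inverse.map (K.map f.2))).app y.1 ≫
          (e.counitIso.hom.app (K.obj y.2)).app y.1 =
            (e.counitIso.hom.app (K.obj x.2)).app y.1 ≫ (K.map f.2).app y.1 :=
        congr($(e.counitIso.hom.naturality (K.map f.2)).app y.1)
      change ((e.functor.obj (e.inverse.obj (K.obj x.2))).map f.1 ≫
        (e.functor.map (e.inverse.map (K.map f.2))).app y.1) ≫
          (e.counitIso.hom.app (K.obj y.2)).app y.1 = 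
            (e.counitIso.hom.app (K.obj x.2)).app x.1 ≫ H.map f
      rw [Category.assoc, h, NatTrans.naturality_assoc]
      congr 1
      change H.map _ ≫ H.map _ = _
      rw [← H.map_comp]
      congr 1
      ext <;> simp [slices])) (fun {F G} α ↦ by
        ext x
        exact congr($(e.counitIso.hom.naturality
          (Functor.whiskerLeft ((slices L I).obj x.2) α)).app x.1))

/-- Both composites unfold to values of `evalAlong G J`, namely at the two sides of `slices_comp`.
-/
lemma whiskeringLeft_comp_undiagrams (G : (L ⥤ B) ⥤ A) {I J : Type u} [Category.{u} I]
    [Category.{u} J] (F : J ⥤ I) :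
    (Functor.whiskeringLeft (L × J) (L × I) B).obj (Functor.prod (𝟭 L) F) ⋙ undiagrams G J =
      undiagrams G I ⋙ (Functor.whiskeringLeft J I A).obj F :=
  congrArg (evalAlong G J).obj (slices_comp L F)

/-- Turns a transport between functors into `G` of an explicit morphism, so that the coherence
conditions can be checked componentwise. -/
lemma evalAlong_map_eqToHom (G : (L ⥤ B) ⥤ A) {I : Type u} [Category.{u} I]
    {S S' : I ⥤ L ⥤ E} (h : S = S') (H : E ⥤ B) (i : I) :
    ((eqToHom (congrArg (evalAlong G I).obj h)).app H).app i =
      G.map (Functor.whiskerRight ((eqToHom h).app i) H) := by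
  subst h
  simp only [eqToHom_refl, NatTrans.id_app, Functor.whiskerRight_id']
  exact (G.map_id _).symm

lemma slices_whisker {I J : Type u} [Category.{u} I] [Category.{u} J] {F F' : J ⥤ I}
    (η : F ⟶ F') :
    Functor.whiskerLeft (slices L J) ((Functor.whiskeringRight L (L × J) (L × I)).map
      (NatTrans.prod (𝟙 (𝟭 L)) η)) = eqToHom (slices_comp L F) ≫
        Functor.whiskerRight η (slices L I) ≫ eqToHom (slices_comp L F').symm := by
  ext j l : 4
  rw [NatTrans.comp_app, NatTrans.comp_app, NatTrans.comp_app, NatTrans.comp_app, eqToHom_app,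
    eqToHom_app, eqToHom_app, eqToHom_app]
  change (𝟙 l, η.app j) = 𝟙 (l, F.obj j) ≫ (𝟙 l, η.app j) ≫ 𝟙 (l, F'.obj j)
  rw [Category.comp_id, Category.id_comp]

/-- Compatibility of the backward transformation with 2-cells, before passing to derived categories:
the image of `slices_whisker` under `evalAlong`. -/
lemma undiagrams_whisker (G : (L ⥤ B) ⥤ A) {I J : Type u} [Category.{u} I]
    [Category.{u} J] {F F' : J ⥤ I} (η : F ⟶ F') :
    Functor.whiskerRight ((Functor.whiskeringLeft (L × J) (L × I) B).map
      (NatTrans.prod (𝟙 (𝟭 L)) η)) (undiagrams G J) =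
        eqToHom (whiskeringLeft_comp_undiagrams G F) ≫
          Functor.whiskerLeft (undiagrams G I) ((Functor.whiskeringLeft J I A).map η) ≫
            eqToHom (whiskeringLeft_comp_undiagrams G F').symm := by
  refine (congrArg (evalAlong G J).map (slices_whisker η)).trans ?_
  rw [Functor.map_comp, Functor.map_comp, eqToHom_map, eqToHom_map]
  rfl

lemma eqToHom_slices_comp_app {I J : Type u} [Category.{u} I] [Category.{u} J] (F : J ⥤ I)
    (j : J) (l : L) : ((eqToHom (slices_comp L F)).app j).app l = 𝟙 (l, F.obj j) := by
  rw [eqToHom_app, eqToHom_app]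
  rfl

/-- The modification axiom for the unit. The forward functor commutes with restriction
definitionally, so the only transport comes from `slices_comp`, and its components are identities.
-/
lemma diagramsUnitIso_whisker (e : A ≌ (L ⥤ B)) {I J : Type u} [Category.{u} I] [Category.{u} J]
    (F : J ⥤ I) :
    Functor.whiskerLeft ((Functor.whiskeringLeft J I A).obj F) (diagramsUnitIso e J).hom ≫
      Functor.whiskerLeft (diagrams e.functor I)
        (eqToHom (whiskeringLeft_comp_undiagrams e.inverse F)) =
      Functor.whiskerRight (diagramsUnitIso e I).hom ((Functor.whiskeringLeft J I A).obj F) := by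
  ext K j
  change (e.unitIso.hom.app (K.obj (F.obj j)) ≫
    e.inverse.map (curryUncurryIso (F ⋙ K ⋙ e.functor) j).hom) ≫
      ((eqToHom (congrArg (evalAlong e.inverse J).obj (slices_comp L F))).app
        ((diagrams e.functor I).obj K)).app j =
      e.unitIso.hom.app (K.obj (F.obj j)) ≫
        e.inverse.map (curryUncurryIso (K ⋙ e.functor) (F.obj j)).hom
  rw [evalAlong_map_eqToHom _ (slices_comp L F)]
  refine (Category.assoc _ _ _).trans (congrArg (e.unitIso.hom.app (K.obj (F.obj j)) ≫ ·) ?_)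
  refine (e.inverse.map_comp _ _).symm.trans (congrArg e.inverse.map ?_)
  ext l
  refine (Category.id_comp _).trans ?_
  refine (congrArg ((diagrams e.functor I).obj K).map (eqToHom_slices_comp_app F j l)).trans ?_
  exact CategoryTheory.Functor.map_id _ _

lemma diagramsCounitIso_whisker (e : A ≌ (L ⥤ B)) {I J : Type u} [Category.{u} I]
    [Category.{u} J] (F : J ⥤ I) :
    Functor.whiskerLeft ((Functor.whiskeringLeft _ _ B).obj (Functor.prod (𝟭 L) F))
      (diagramsCounitIso e J).hom =
    Functor.whiskerRight (eqToHom (whiskeringLeft_comp_undiagrams e.inverse F))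
        (diagrams e.functor J) ≫
      Functor.whiskerRight (diagramsCounitIso e I).hom
        ((Functor.whiskeringLeft _ _ B).obj (Functor.prod (𝟭 L) F)) := by
  ext H ⟨l, j⟩
  change (e.counitIso.hom.app ((slices L J).obj j ⋙ Functor.prod (𝟭 L) F ⋙ H)).app l =
    (e.functor.map (((eqToHom (congrArg (evalAlong e.inverse J).obj (slices_comp L F))).app
      H).app j)).app l ≫ (e.counitIso.hom.app ((slices L I).obj (F.obj j) ⋙ H)).app l
  rw [evalAlong_map_eqToHom _ (slices_comp L F)]
  -- Naturality of the counit of `e` moves the transport past it, where it becomes `H` of an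
  -- identity.
  have h := congr($(e.counitIso.hom.naturality
    (Functor.whiskerRight ((eqToHom (slices_comp L F)).app j) H)).app l)
  refine Eq.trans ?_ h.symm
  refine ((Category.comp_id _).symm.trans ?_)
  congr 1
  exact ((congrArg H.map (eqToHom_slices_comp_app F j l)).trans
    (CategoryTheory.Functor.map_id _ _)).symm

lemma comp_eqToHom_comp_eqToHom {C : Type*} [Category* C] {X Y Z : C} (f : X ⟶ Y) (h : Y = Z)
    (h' : Z = Y) : (f ≫ eqToHom h) ≫ eqToHom h' = f := by
  subst h; simp

lemma whiskerLeft_eqToHom' {C D E : Type*} [Category* C] [Category* D] [Category* E] (F : C ⥤ D)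
    {G G' : D ⥤ E} (h : G = G') :
    Functor.whiskerLeft F (eqToHom h) = eqToHom (congrArg (F ⋙ ·) h) := by
  subst h; rfl

lemma eqToHom_whiskerRight' {C D E : Type*} [Category* C] [Category* D] [Category* E]
    {G G' : C ⥤ D} (h : G = G') (F : D ⥤ E) :
    Functor.whiskerRight (eqToHom h) F = eqToHom (congrArg (· ⋙ F) h) := by
  subst h; exact Functor.whiskerRight_id' _

section

variable {I J : Type u} [Category.{u} I] [Category.{u} J] (F : J ⥤ I)

lemma unit_target_eq (e : A ≌ (L ⥤ B)) : (diagrams e.functor I ⋙ undiagrams e.inverse I) ⋙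
    (Functor.whiskeringLeft J I A).obj F = (Functor.whiskeringLeft J I A).obj F ⋙
      diagrams e.functor J ⋙ undiagrams e.inverse J :=
  (congrArg (diagrams e.functor I ⋙ ·) (whiskeringLeft_comp_undiagrams e.inverse F)).symm

/-- The shape `eqToHom ≫ _ ≫ eqToHom` is the input of `Derived.heq_Q_map`, hence the vacuous
`eqToHom rfl`. -/
lemma diagramsUnitIso_whisker' (e : A ≌ (L ⥤ B)) :
    Functor.whiskerLeft ((Functor.whiskeringLeft J I A).obj F) (diagramsUnitIso e J).hom =
      eqToHom rfl ≫ Functor.whiskerRight (diagramsUnitIso e I).hom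
        ((Functor.whiskeringLeft J I A).obj F) ≫ eqToHom (unit_target_eq F e) := by
  rw [← diagramsUnitIso_whisker, whiskerLeft_eqToHom' _ (whiskeringLeft_comp_undiagrams e.inverse F)]
  simp only [eqToHom_refl, Category.id_comp]
  exact (comp_eqToHom_comp_eqToHom _ _ (unit_target_eq F e)).symm

lemma counit_source_eq (e : A ≌ (L ⥤ B)) : (Functor.whiskeringLeft _ _ B).obj (Functor.prod (𝟭 L) F) ⋙
    undiagrams e.inverse J ⋙ diagrams e.functor J =
      (undiagrams e.inverse I ⋙ diagrams e.functor I) ⋙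
        (Functor.whiskeringLeft _ _ B).obj (Functor.prod (𝟭 L) F) :=
  (congrArg (· ⋙ diagrams e.functor J) (whiskeringLeft_comp_undiagrams e.inverse F))

lemma diagramsCounitIso_whisker' (e : A ≌ (L ⥤ B)) :
    Functor.whiskerLeft ((Functor.whiskeringLeft _ _ B).obj (Functor.prod (𝟭 L) F))
      (diagramsCounitIso e J).hom =
    eqToHom (counit_source_eq F e) ≫ Functor.whiskerRight (diagramsCounitIso e I).hom
      ((Functor.whiskeringLeft _ _ B).obj (Functor.prod (𝟭 L) F)) ≫ eqToHom rfl := by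
  rw [diagramsCounitIso_whisker, eqToHom_whiskerRight' (whiskeringLeft_comp_undiagrams e.inverse F)]
  simp only [eqToHom_refl, Category.comp_id]
  rfl

end

instance (e : A ≌ (L ⥤ B)) (I : Type u) [Category.{u} I] :
    (diagrams e.functor I).IsEquivalence :=
  (CategoryTheory.Equivalence.mk _ _ (diagramsUnitIso e I) (diagramsCounitIso e I)).isEquivalence_functor

instance (e : A ≌ (L ⥤ B)) (I : Type u) [Category.{u} I] :
    (undiagrams e.inverse I).IsEquivalence :=
  (CategoryTheory.Equivalence.mk _ _ (diagramsUnitIso e I) (diagramsCounitIso e I)).isEquivalence_inverse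

end diagrams

variable {A : Type (u + 1)} [Category.{u} A] [Abelian A] {B : Type (u + 1)} [Category.{u} B]
  [Abelian B] {L : Type u} [Category.{u} L] (e : A ≌ (L ⥤ B))

/-- An equivalence is additive and exact, so it acts degreewise on complexes and preserves
quasi-isomorphisms. -/
instance (I : Type u) [Category.{u} I] : (diagrams e.functor I).Additive :=
  Functor.additive_of_preserves_binary_products _

instance (I : Type u) [Category.{u} I] : (undiagrams e.inverse I).Additive :=
  Functor.additive_of_preserves_binary_products _

instance (I : Type u) [Category.{u} I] : (diagrams e.functor I).PreservesHomology := inferInstance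

instance (I : Type u) [Category.{u} I] : (undiagrams e.inverse I).PreservesHomology := inferInstance

end

end Prederivator

/-! ### Passage to derived categories and the strong equivalence. -/

namespace Prederivator

noncomputable section

open Bicategory
open scoped Pseudofunctor.StrongTrans

section

variable {A : Type w} [Category.{v} A] [Abelian A] {B : Type w} [Category.{v} B] [Abelian B]
  {C : Type w} [Category.{v} C] [Abelian C]

/-- Functors out of a derived category agree if they agree on complexes. -/
lemma Derived.functor_ext {D : Type*} [Category* D] {F G : Derived A ⥤ D}
    (h : Derived.Q A ⋙ F = Derived.Q A ⋙ G) : F = G :=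
  Localization.Construction.uniq _ _ h

lemma Derived.Q_map_comp (F : A ⥤ B) [F.Additive] [F.PreservesHomology] (G : B ⥤ C)
    [G.Additive] [G.PreservesHomology] :
    Derived.Q A ⋙ Derived.map F ⋙ Derived.map G =
      F.mapHomologicalComplex (ComplexShape.up ℤ) ⋙ G.mapHomologicalComplex (ComplexShape.up ℤ) ⋙
        Derived.Q C := by
  rw [← Functor.assoc, Derived.Q_map, Functor.assoc, Derived.Q_map]

lemma Derived.map_map_Q_map (F : A ⥤ B) [F.Additive] [F.PreservesHomology] (G : B ⥤ C)
    [G.Additive] [G.PreservesHomology] {K K' : CochainComplex A ℤ} (f : K ⟶ K') :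
    (Derived.map G).map ((Derived.map F).map ((Derived.Q A).map f)) =
      (Derived.Q C).map ((G.mapHomologicalComplex (ComplexShape.up ℤ)).map
        ((F.mapHomologicalComplex (ComplexShape.up ℤ)).map f)) :=
  (congrArg (Derived.map G).map (Derived.map_Q_map F f)).trans (Derived.map_Q_map G _)

lemma Derived.mapHomologicalComplex_congr {F F' : A ⥤ B} [F.PreservesZeroMorphisms]
    [F'.PreservesZeroMorphisms] (h : F = F') :
    F.mapHomologicalComplex (ComplexShape.up ℤ) ⋙ Derived.Q B =
      F'.mapHomologicalComplex (ComplexShape.up ℤ) ⋙ Derived.Q B := by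
  subst h; rfl

/-- In the derived category the two morphisms have ends that are only propositionally equal.
Heterogeneous equality lets all transports be settled between functors of abelian categories. -/
lemma Derived.heq_Q_map {F F' G G' : A ⥤ B} [F.PreservesZeroMorphisms]
    [F'.PreservesZeroMorphisms] [G.PreservesZeroMorphisms] [G'.PreservesZeroMorphisms]
    (h : F = F') (h' : G' = G) (α : F ⟶ G) (β : F' ⟶ G')
    (H : α = eqToHom h ≫ β ≫ eqToHom h') (K : CochainComplex A ℤ) :
    HEq ((Derived.Q B).map ((NatTrans.mapHomologicalComplex α (ComplexShape.up ℤ)).app K))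
      ((Derived.Q B).map ((NatTrans.mapHomologicalComplex β (ComplexShape.up ℤ)).app K)) := by
  subst h h'
  simp only [eqToHom_refl, Category.id_comp, Category.comp_id] at H
  subst H
  rfl

/-- The natural transformation `𝟭 ⟶ D(F) ⋙ D(G)` induced by `𝟭 ⟶ F ⋙ G`. -/
def Derived.unit (F : A ⥤ B) [F.Additive] [F.PreservesHomology] (G : B ⥤ A)
    [G.Additive] [G.PreservesHomology] (α : 𝟭 A ⟶ F ⋙ G) :
    𝟭 (Derived A) ⟶ Derived.map F ⋙ Derived.map G :=
  Localization.Construction.natTransExtension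
    { app K := (Derived.Q A).map (Y := ((G.mapHomologicalComplex (ComplexShape.up ℤ)).obj
        ((F.mapHomologicalComplex (ComplexShape.up ℤ)).obj K)))
          { f n := α.app (K.X n), comm' _ _ _ := (α.naturality _).symm }
      naturality K K' f := by
        change (Derived.Q A).map _ ≫ (Derived.Q A).map _ =
          (Derived.Q A).map _ ≫ (Derived.map G).map ((Derived.map F).map ((Derived.Q A).map f))
        rw [Derived.map_map_Q_map]
        refine ((Derived.Q A).map_comp _ _).symm.trans
          ((congrArg (Derived.Q A).map ?_).trans ((Derived.Q A).map_comp _ _))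
        ext n
        exact α.naturality _ }

/-- The natural transformation `D(F) ⋙ D(G) ⟶ 𝟭` induced by `F ⋙ G ⟶ 𝟭`. -/
def Derived.counit (F : A ⥤ B) [F.Additive] [F.PreservesHomology] (G : B ⥤ A)
    [G.Additive] [G.PreservesHomology] (α : F ⋙ G ⟶ 𝟭 A) :
    Derived.map F ⋙ Derived.map G ⟶ 𝟭 (Derived A) :=
  Localization.Construction.natTransExtension
    { app K := (Derived.Q A).map (X := ((G.mapHomologicalComplex (ComplexShape.up ℤ)).obj
        ((F.mapHomologicalComplex (ComplexShape.up ℤ)).obj K)))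
          { f n := α.app (K.X n), comm' _ _ _ := (α.naturality _).symm }
      naturality K K' f := by
        change (Derived.map G).map ((Derived.map F).map ((Derived.Q A).map f)) ≫
          (Derived.Q A).map _ = (Derived.Q A).map _ ≫ (Derived.Q A).map _
        rw [Derived.map_map_Q_map]
        refine ((Derived.Q A).map_comp _ _).symm.trans
          ((congrArg (Derived.Q A).map ?_).trans ((Derived.Q A).map_comp _ _))
        ext n
        exact α.naturality _ }

section
variable (F : A ⥤ B) [F.Additive] [F.PreservesHomology] (G : B ⥤ A)
    [G.Additive] [G.PreservesHomology]

lemma Derived.unit_app (α : 𝟭 A ⟶ F ⋙ G) (K : CochainComplex A ℤ) :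
    (Derived.unit F G α).app ((Derived.Q A).obj K) =
      (Derived.Q A).map (Y := ((G.mapHomologicalComplex (ComplexShape.up ℤ)).obj
        ((F.mapHomologicalComplex (ComplexShape.up ℤ)).obj K)))
          { f n := α.app (K.X n), comm' _ _ _ := (α.naturality _).symm } :=
  (Localization.Construction.natTransExtension_app _ _).trans
    (Localization.Construction.NatTransExtension.app_eq _ _)

lemma Derived.counit_app (α : F ⋙ G ⟶ 𝟭 A) (K : CochainComplex A ℤ) :
    (Derived.counit F G α).app ((Derived.Q A).obj K) =
      (Derived.Q A).map (X := ((G.mapHomologicalComplex (ComplexShape.up ℤ)).obj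
        ((F.mapHomologicalComplex (ComplexShape.up ℤ)).obj K)))
          { f n := α.app (K.X n), comm' _ _ _ := (α.naturality _).symm } :=
  (Localization.Construction.natTransExtension_app _ _).trans
    (Localization.Construction.NatTransExtension.app_eq _ _)

/-- `Derived.unit` of an isomorphism. -/
def Derived.unitIso (α : 𝟭 A ≅ F ⋙ G) : 𝟭 (Derived A) ≅ Derived.map F ⋙ Derived.map G where
  hom := Derived.unit F G α.hom
  inv := Derived.counit F G α.inv
  hom_inv_id := Derived.map₂_ext fun K ↦ by
    rw [NatTrans.comp_app, Derived.unit_app, Derived.counit_app]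
    refine ((Derived.Q A).map_comp _ _).symm.trans
      ((congrArg (Derived.Q A).map ?_).trans ((Derived.Q A).map_id K))
    ext n
    exact α.hom_inv_id_app _
  inv_hom_id := Derived.map₂_ext fun K ↦ by
    rw [NatTrans.comp_app, Derived.unit_app, Derived.counit_app]
    refine ((Derived.Q A).map_comp _ _).symm.trans
      ((congrArg (Derived.Q A).map ?_).trans ((Derived.Q A).map_id _))
    ext n
    exact α.inv_hom_id_app _

end

end

variable {A : Type (u + 1)} [Category.{u} A] [Abelian A] {B : Type (u + 1)} [Category.{u} B]
  [Abelian B] {L : Type u} [Category.{u} L] (e : A ≌ (L ⥤ B))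

/-- The strict 2-natural transformation induced by `diagrams`. -/
def diagramsTrans : (ofAbelian A).toPseudofunctor ⟶
    ((ofAbelian B).shift (Cat.of L)).toPseudofunctor :=
  StrictPseudofunctor.strongTransOfStrict
    (fun I ↦ (Derived.map (diagrams e.functor I.unop)).toCatHom)
    (fun {I J} F ↦ by
      ext : 1
      refine Derived.functor_ext ?_
      -- On complexes the two composites agree definitionally; `undiagramsTrans` needs the equality
      -- `whiskeringLeft_comp_undiagrams` here.
      exact (Derived.Q_map_comp ((Functor.whiskeringLeft _ _ A).obj F.unop.toFunctor)
        (diagrams e.functor J.unop)).trans (Derived.Q_map_comp (diagrams e.functor I.unop)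
          ((Functor.whiskeringLeft _ _ B).obj (Functor.prod (𝟭 L) F.unop.toFunctor))).symm)
    (fun {I J F G} η ↦ cat_hom₂_eq_conj _ _ _ _ fun X ↦ by
      obtain ⟨K, rfl⟩ := (Localization.Construction.objEquiv _).surjective X
      refine (heq_of_eq ((congrArg (Derived.map (diagrams e.functor J.unop)).map
        (Derived.map₂_app ((Functor.whiskeringLeft _ _ A).map η.unop2.toNatTrans) K)).trans
          (Derived.map_Q_map (diagrams e.functor J.unop) _))).trans ?_
      refine HEq.trans (heq_of_eq (congrArg (Derived.Q (L × J.unop ⥤ B)).map ?_)) (heq_of_eq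
        (Derived.map₂_app ((Functor.whiskeringLeft _ _ B).map
          (NatTrans.prod (𝟙 (𝟭 L)) η.unop2.toNatTrans))
            (((diagrams e.functor I.unop).mapHomologicalComplex _).obj K)).symm)
      ext n ⟨l, j⟩
      -- Uncurrying splits the action of `(𝟙 l, η)` into two factors, the first being the image of
      -- an identity.
      change _ = (e.functor.obj _).map (𝟙 l) ≫ _
      erw [CategoryTheory.Functor.map_id, Category.id_comp]
      rfl)

/-- The strict 2-natural transformation induced by `undiagrams`. -/
def undiagramsTrans : ((ofAbelian B).shift (Cat.of L)).toPseudofunctor ⟶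
    (ofAbelian A).toPseudofunctor :=
  StrictPseudofunctor.strongTransOfStrict
    (fun I ↦ (Derived.map (undiagrams e.inverse I.unop)).toCatHom)
    (fun {I J} F ↦ by
      ext : 1
      refine Derived.functor_ext ?_
      refine (Derived.Q_map_comp ((Functor.whiskeringLeft _ _ B).obj
        (Functor.prod (𝟭 L) F.unop.toFunctor)) (undiagrams e.inverse J.unop)).trans ?_
      refine Eq.trans ?_ (Derived.Q_map_comp (undiagrams e.inverse I.unop)
          ((Functor.whiskeringLeft _ _ A).obj F.unop.toFunctor)).symm
      exact Derived.mapHomologicalComplex_congr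
        (whiskeringLeft_comp_undiagrams e.inverse F.unop.toFunctor))
    (fun {I J F G} η ↦ cat_hom₂_eq_conj _ _ _ _ fun X ↦ by
      obtain ⟨K, rfl⟩ := (Localization.Construction.objEquiv _).surjective X
      refine (heq_of_eq ((congrArg (Derived.map (undiagrams e.inverse J.unop)).map
        (Derived.map₂_app ((Functor.whiskeringLeft _ _ B).map
          (NatTrans.prod (𝟙 (𝟭 L)) η.unop2.toNatTrans)) K)).trans
          (Derived.map_Q_map (undiagrams e.inverse J.unop) _))).trans ?_
      refine HEq.trans ?_ (heq_of_eq
        (Derived.map₂_app ((Functor.whiskeringLeft _ _ A).map η.unop2.toNatTrans)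
          (((undiagrams e.inverse I.unop).mapHomologicalComplex _).obj K)).symm)
      exact Derived.heq_Q_map (whiskeringLeft_comp_undiagrams e.inverse F.unop.toFunctor)
        (whiskeringLeft_comp_undiagrams e.inverse G.unop.toFunctor).symm _ _
        (undiagrams_whisker e.inverse η.unop2.toNatTrans) K)

lemma diagramsTrans_isStrict :
    Pseudofunctor.StrongTrans.IsStrict (diagramsTrans e) :=
  ⟨fun _ ↦ ⟨_, rfl⟩⟩

lemma undiagramsTrans_isStrict :
    Pseudofunctor.StrongTrans.IsStrict (undiagramsTrans e) :=
  ⟨fun _ ↦ ⟨_, rfl⟩⟩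

/-- The unit of the strong equivalence induced by `e`. -/
def diagramsTransUnitIso : 𝟙 (ofAbelian A).toPseudofunctor ≅ diagramsTrans e ≫ undiagramsTrans e :=
  Pseudofunctor.StrongTrans.isoMkOfStrict (Pseudofunctor.StrongTrans.isStrict_id _)
    ((diagramsTrans_isStrict e).comp (undiagramsTrans_isStrict e))
    (fun I ↦ Cat.Hom.isoMk (Derived.unitIso (diagrams e.functor I.unop) (undiagrams e.inverse I.unop)
      (diagramsUnitIso e I.unop)))
    (fun {I J} F ↦ cat_hom₂_eq_conj _ _ _ _ fun X ↦ by
      obtain ⟨K, rfl⟩ := (Localization.Construction.objEquiv _).surjective X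
      refine (heq_of_eq (Derived.unit_app (diagrams e.functor J.unop) (undiagrams e.inverse J.unop)
        (diagramsUnitIso e J.unop).hom ((((Functor.whiskeringLeft _ _ A).obj
          F.unop.toFunctor).mapHomologicalComplex _).obj K))).trans ?_
      refine HEq.trans ?_ (heq_of_eq ((congrArg (Derived.map ((Functor.whiskeringLeft _ _ A).obj
          F.unop.toFunctor)).map (Derived.unit_app (diagrams e.functor I.unop)
            (undiagrams e.inverse I.unop) (diagramsUnitIso e I.unop).hom K)).trans
              (Derived.map_Q_map _ _)).symm)
      exact Derived.heq_Q_map (F := (Functor.whiskeringLeft _ _ A).obj F.unop.toFunctor)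
        (F' := (Functor.whiskeringLeft _ _ A).obj F.unop.toFunctor) rfl
        (unit_target_eq F.unop.toFunctor e) _ _
        (diagramsUnitIso_whisker' F.unop.toFunctor e) K)

/-- The counit of the strong equivalence induced by `e`. -/
def diagramsTransCounitIso : undiagramsTrans e ≫ diagramsTrans e ≅
    𝟙 ((ofAbelian B).shift (Cat.of L)).toPseudofunctor :=
  Pseudofunctor.StrongTrans.isoMkOfStrict
    ((undiagramsTrans_isStrict e).comp (diagramsTrans_isStrict e))
    (Pseudofunctor.StrongTrans.isStrict_id _)
    -- With the two functors exchanged, the counit is the inverse of a unit.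
    (fun I ↦ Cat.Hom.isoMk (Derived.unitIso (undiagrams e.inverse I.unop) (diagrams e.functor I.unop)
      (diagramsCounitIso e I.unop).symm).symm)
    (fun {I J} F ↦ cat_hom₂_eq_conj _ _ _ _ fun X ↦ by
      obtain ⟨K, rfl⟩ := (Localization.Construction.objEquiv _).surjective X
      refine (heq_of_eq (Derived.counit_app (undiagrams e.inverse J.unop) (diagrams e.functor J.unop)
        (diagramsCounitIso e J.unop).hom ((((Functor.whiskeringLeft _ _ B).obj
          (Functor.prod (𝟭 L) F.unop.toFunctor)).mapHomologicalComplex _).obj K))).trans ?_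
      refine HEq.trans ?_ (heq_of_eq ((congrArg (Derived.map ((Functor.whiskeringLeft _ _ B).obj
          (Functor.prod (𝟭 L) F.unop.toFunctor))).map (Derived.counit_app (undiagrams e.inverse I.unop)
            (diagrams e.functor I.unop) (diagramsCounitIso e I.unop).hom K)).trans
              (Derived.map_Q_map _ _)).symm)
      exact Derived.heq_Q_map
        (G := (Functor.whiskeringLeft _ _ B).obj (Functor.prod (𝟭 L) F.unop.toFunctor))
        (G' := (Functor.whiskeringLeft _ _ B).obj (Functor.prod (𝟭 L) F.unop.toFunctor))
        (counit_source_eq F.unop.toFunctor e) rfl _ _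
        (diagramsCounitIso_whisker' F.unop.toFunctor e) K)

/-- The strong equivalence of prederivators induced by an equivalence `A ≌ B^L`. -/
def strongEquivalence : StrongEquivalence (ofAbelian A) ((ofAbelian B).shift (Cat.of L)) where
  -- Enforcing the triangle identities changes only the counit; both transformations, and so their
  -- strictness, are kept.
  equiv := Bicategory.Equivalence.mkOfAdjointifyCounit (diagramsTransUnitIso e)
    (diagramsTransCounitIso e)
  hom_strict := (diagramsTrans_isStrict e).naturality_eq
  inv_strict := (undiagramsTrans_isStrict e).naturality_eq

lemma Q_strongEquivalence_functor (I : Cat.{u, u}) :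
    Derived.Q (I ⥤ A) ⋙ (strongEquivalence e).functor I =
      (diagrams e.functor I).mapHomologicalComplex (ComplexShape.up ℤ) ⋙ Derived.Q (L × I ⥤ B) :=
  Derived.Q_map _

end

end Prederivator

/-! ### Quasi-coherence as localization of sections over affine opens. -/

namespace AlgebraicGeometry.Scheme.Modules

open TopologicalSpace

variable {X : Scheme.{u}}

/-- Restriction of sections of a module to a smaller open. -/
noncomputable abbrev res (M : X.Modules) {U V : X.Opens} (h : V ≤ U) (s : Γ(M, U)) : Γ(M, V) :=
  M.presheaf.map (homOfLE h).op s

/-- Restriction of functions to a smaller open. -/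
noncomputable abbrev _root_.AlgebraicGeometry.Scheme.res (X : Scheme.{u}) {U V : X.Opens}
    (h : V ≤ U) (r : Γ(X, U)) : Γ(X, V) :=
  X.presheaf.map (homOfLE h).op r

lemma res_self (M : X.Modules) {U : X.Opens} (h : U ≤ U) (s : Γ(M, U)) : M.res h s = s := by
  change M.presheaf.map (𝟙 _) s = s
  rw [CategoryTheory.Functor.map_id]; rfl

lemma res_smul (M : X.Modules) {U V : X.Opens} (h : V ≤ U) (r : Γ(X, U)) (s : Γ(M, U)) :
    M.res h (r • s) = X.res h r • M.res h s :=
  M.map_smul _ _ _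

lemma app_res {M N : X.Modules} (f : M ⟶ N) {U V : X.Opens} (h : V ≤ U) (s : Γ(M, U)) :
    f.app V (M.res h s) = N.res h (f.app U s) :=
  congr($(f.mapPresheaf.naturality (homOfLE h).op) s)

/-- The restriction of sections of `M` from `U` to `V` is a localization at `f`, provided that `f`
is invertible on `V`. -/
structure IsLocalizationOn (M : X.Modules) {U V : X.Opens} (h : V ≤ U) (f : Γ(X, U)) : Prop where
  exists_res_eq (s : Γ(M, V)) : ∃ (n : ℕ) (t : Γ(M, U)), M.res h t = X.res h (f ^ n) • s
  exists_smul_eq_zero (t : Γ(M, U)) (ht : M.res h t = 0) : ∃ n : ℕ, f ^ n • t = 0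

/-- The sections of `M` over `D(f) ⊆ U` are the localization at `f` of the sections over `U`. -/
abbrev IsLocalizingAt (M : X.Modules) (U : X.Opens) (f : Γ(X, U)) : Prop :=
  M.IsLocalizationOn (X.basicOpen_le f) f

lemma isLocalizationOn_iff_of_eq (M : X.Modules) {U V V' : X.Opens} (h : V ≤ U) (e : V' = V)
    (f : Γ(X, U)) : M.IsLocalizationOn h f ↔ M.IsLocalizationOn (e.trans_le h) f := by
  subst e; rfl

lemma isLocalizing_iff_isLocalizingAt {R : CommRingCat.{u}} (M : (Spec R).Modules) :
    IsLocalizing (modulesSpecToSheaf.obj M) ↔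
      ∀ f : R, M.IsLocalizingAt ⊤ ((ΓSpecIso R).inv f) := by
  refine forall_congr' fun f ↦ ?_
  have hV : PrimeSpectrum.basicOpen f = (Spec R).basicOpen ((ΓSpecIso R).inv f) :=
    (basicOpen_eq_of_affine f).symm
  rw [hV]
  generalize hW : (Spec R).basicOpen ((ΓSpecIso R).inv f) = V
  let φ : Γ(M, ⊤) →ₗ[R] Γ(M, V) := ((modulesSpecToSheaf.obj M).obj.map V.leTop.op).hom
  have hV' : V ≤ PrimeSpectrum.basicOpen f := (hV.trans hW).ge
  have key (n : ℕ) (s : Γ(M, V)) :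
      f ^ n • s = (Spec R).res (le_top : V ≤ ⊤) ((ΓSpecIso R).inv f ^ n) • s := by
    rw [smul_Spec_def, map_pow]
    rfl
  have key' (n : ℕ) (s : Γ(M, ⊤)) : f ^ n • s = (ΓSpecIso R).inv f ^ n • s := by
    rw [smul_Spec_def, map_pow]
    exact congrArg (· • s) (congr($((Spec R).presheaf.map_id _) _))
  change IsLocalizedModule (.powers f) φ ↔ _
  refine ⟨fun h ↦ ?_, fun h ↦ IsLocalizedModule.Away.mk_of_addCommGroup ?_ ?_ ?_⟩
  · subst hW
    refine ⟨fun s ↦ ?_, fun t ht ↦ ?_⟩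
    · obtain ⟨⟨t, ⟨_, n, rfl⟩⟩, hy⟩ := h.surj s
      exact ⟨n, t, hy.symm.trans (key n s)⟩
    · obtain ⟨⟨_, n, rfl⟩, hn⟩ := (IsLocalizedModule.eq_zero_iff (.powers f) φ).mp ht
      exact ⟨n, (key' n t).symm.trans hn⟩
  · exact isUnit_algebraMap_end_of_le_basicOpen f hV'
  · subst hW
    intro s
    obtain ⟨n, t, ht⟩ := h.exists_res_eq s
    exact ⟨n, t, (key n s).trans ht.symm⟩
  · subst hW
    intro t ht
    obtain ⟨n, hn⟩ := h.exists_smul_eq_zero t ht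
    exact ⟨n, (key' n t).trans hn⟩

lemma isLocalizationOn_restrict_iff {Y : Scheme.{u}} (M : X.Modules) (j : Y ⟶ X)
    [IsOpenImmersion j] {U V : Y.Opens} (h : V ≤ U) (f : Γ(Y, U)) :
    (M.restrict j).IsLocalizationOn h f ↔
      M.IsLocalizationOn (j.image_mono h) ((j.appIso U).inv f) := by
  have key (n : ℕ) : (j.appIso V).inv (Y.res h (f ^ n)) =
      X.res (j.image_mono h) ((j.appIso U).inv f ^ n) := by
    rw [← map_pow]
    exact congr($(j.appIso_inv_naturality (homOfLE h).op) (f ^ n))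
  have key' (n : ℕ) (t : Γ(M.restrict j, U)) :
      f ^ n • t = ((j.appIso U).inv f ^ n • (show Γ(M, j ''ᵁ U) from t)) := by
    rw [← map_pow]; rfl
  refine ⟨fun H ↦ ⟨fun s ↦ ?_, fun t ht ↦ ?_⟩, fun H ↦ ⟨fun s ↦ ?_, fun t ht ↦ ?_⟩⟩
  · obtain ⟨n, t, ht⟩ := H.exists_res_eq s
    exact ⟨n, t, ht.trans (congrArg (· • s) (key n))⟩
  · obtain ⟨n, hn⟩ := H.exists_smul_eq_zero t ht
    exact ⟨n, (key' n t).symm.trans hn⟩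
  · obtain ⟨n, t, ht⟩ := H.exists_res_eq s
    exact ⟨n, t, ht.trans (congrArg (fun r ↦ (r • (show Γ(M, j ''ᵁ V) from s))) (key n).symm)⟩
  · obtain ⟨n, hn⟩ := H.exists_smul_eq_zero t ht
    exact ⟨n, (key' n t).trans hn⟩

lemma isLocalizationOn_pushforward_iff {Y : Scheme.{u}} (M : Y.Modules) (π : Y ⟶ X)
    {U V : X.Opens} (h : V ≤ U) (f : Γ(X, U)) :
    ((pushforward π).obj M).IsLocalizationOn h f ↔
      M.IsLocalizationOn (π.preimage_mono h) (π.app U f) := by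
  have key (n : ℕ) : π.app V (X.res h (f ^ n)) = Y.res (π.preimage_mono h) (π.app U f ^ n) := by
    rw [← map_pow]
    exact congr($(π.naturality (homOfLE h).op) (f ^ n))
  have key' (n : ℕ) (t : Γ((pushforward π).obj M, U)) :
      f ^ n • t = ((π.app U f ^ n • (show Γ(M, π ⁻¹ᵁ U) from t))) := by
    rw [← map_pow]; rfl
  refine ⟨fun H ↦ ⟨fun s ↦ ?_, fun t ht ↦ ?_⟩, fun H ↦ ⟨fun s ↦ ?_, fun t ht ↦ ?_⟩⟩
  · obtain ⟨n, t, ht⟩ := H.exists_res_eq s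
    exact ⟨n, t, ht.trans (congrArg (· • s) (key n))⟩
  · obtain ⟨n, hn⟩ := H.exists_smul_eq_zero t ht
    exact ⟨n, (key' n t).symm.trans hn⟩
  · obtain ⟨n, t, ht⟩ := H.exists_res_eq s
    exact ⟨n, t, ht.trans (congrArg (fun r ↦ (r • (show Γ(M, π ⁻¹ᵁ V) from s))) (key n).symm)⟩
  · obtain ⟨n, hn⟩ := H.exists_smul_eq_zero t ht
    exact ⟨n, (key' n t).trans hn⟩

/-- The localization criterion on `Spec R`, carried along the ring isomorphism `R ≅ Γ(X, j ''ᵁ ⊤)`.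
-/
lemma isQuasicoherent_restrict_iff {R : CommRingCat.{u}} (M : X.Modules) (j : Spec R ⟶ X)
    [IsOpenImmersion j] :
    (M.restrict j).IsQuasicoherent ↔ ∀ g : Γ(X, j ''ᵁ ⊤), M.IsLocalizingAt (j ''ᵁ ⊤) g := by
  rw [isQuasicoherent_iff_isIso_fromTildeΓ, isIso_fromTildeΓ_iff_isLocalizing,
    isLocalizing_iff_isLocalizingAt]
  let ι : R ≅ Γ(X, j ''ᵁ ⊤) := (ΓSpecIso R).symm ≪≫ (j.appIso ⊤).symm
  have hι : Function.Surjective ι.hom := (ConcreteCategory.bijective_of_isIso ι.hom).2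
  rw [hι.forall]
  refine forall_congr' fun f ↦ (isLocalizationOn_restrict_iff M j _ _).trans ?_
  exact isLocalizationOn_iff_of_eq _ _ (image_basicOpen j _).symm _

/-- Quasi-coherence in terms of sections over affine opens. -/
lemma isQuasicoherent_iff_isLocalizingAt (M : X.Modules) :
    M.IsQuasicoherent ↔
      ∀ (U : X.Opens), IsAffineOpen U → ∀ f : Γ(X, U), M.IsLocalizingAt U f := by
  rw [isQuasicoherent_iff_affine]
  refine forall_congr' fun U ↦ forall_congr' fun hU ↦ ?_
  rw [isQuasicoherent_restrict_iff]
  have h : hU.fromSpec ''ᵁ ⊤ = U := by simp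
  rw [h]

/-- `π ⁻¹ᵁ U` is affine and the preimage of `D(f)` is the basic open of the pulled-back function, so
the criterion for the direct image on `U` is that for `M` on `π ⁻¹ᵁ U`. -/
lemma isQuasicoherent_pushforward {Y : Scheme.{u}} (π : Y ⟶ X) [IsAffineHom π] (M : Y.Modules)
    [hM : M.IsQuasicoherent] : ((pushforward π).obj M).IsQuasicoherent := by
  rw [isQuasicoherent_iff_isLocalizingAt] at hM ⊢
  intro U hU f
  refine (isLocalizationOn_pushforward_iff M π _ f).2 ?_
  exact (isLocalizationOn_iff_of_eq _ _ (preimage_basicOpen π f) _).1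
    (hM _ (hU.preimage π) (π.app U f))

end AlgebraicGeometry.Scheme.Modules

/-! ### Morphisms into modules extended from an affine open. -/

namespace AlgebraicGeometry.Scheme.Modules

open TopologicalSpace

variable {X : Scheme.{u}}

lemma res_ext (M : X.Modules) {W : X.Opens} {s t : Γ(M, W)}
    (h : ∀ x ∈ W, ∃ (V : X.Opens) (hV : V ≤ W), x ∈ V ∧ M.res hV s = M.res hV t) : s = t := by
  refine TopCat.Presheaf.IsSheaf.section_ext M.isSheaf fun x hx ↦ ?_
  obtain ⟨V, hV, hxV, e⟩ := h x hx
  exact ⟨V, hV, hxV, e⟩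

lemma res_zero (M : X.Modules) {U V : X.Opens} (h : V ≤ U) : M.res h 0 = 0 :=
  map_zero (M.presheaf.map (homOfLE h).op).hom

lemma isUnit_res_basicOpen {U : X.Opens} (r : Γ(X, U)) (n : ℕ) :
    IsUnit (X.res (X.basicOpen_le r) (r ^ n)) := by
  rw [Scheme.res, map_pow]
  exact (RingedSpace.isUnit_res_basicOpen X.toRingedSpace r).pow n

/-- Two morphisms out of a quasi-coherent module that agree on sections over an affine open `U`
agree over all smaller opens. -/
lemma app_eq_of_app_eq {M N : X.Modules} [hM : M.IsQuasicoherent] {f g : M ⟶ N} {U : X.Opens}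
    (hU : IsAffineOpen U) (h : ∀ s, f.app U s = g.app U s) {W : X.Opens} (hW : W ≤ U)
    (s : Γ(M, W)) : f.app W s = g.app W s := by
  rw [isQuasicoherent_iff_isLocalizingAt] at hM
  refine res_ext _ fun x hx ↦ ?_
  obtain ⟨r, hr, hxr⟩ := hU.exists_basicOpen_le ⟨x, hx⟩ (hW hx)
  refine ⟨_, hr, hxr, ?_⟩
  rw [← app_res, ← app_res]
  -- Up to a power of `r`, which is a unit on `D(r)`, the section lifts to `U`, where the hypothesis
  -- applies.
  obtain ⟨n, t, ht⟩ := (hM U hU r).exists_res_eq (M.res hr s)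
  rw [← (isUnit_res_basicOpen r n).smul_left_cancel, ← Hom.app_smul, ← Hom.app_smul, ← ht,
    app_res, app_res, h]

/-- Injectivity of a morphism of quasi-coherent modules can be checked over an affine open. -/
lemma app_injective_of_app_injective {M N : X.Modules} [hM : M.IsQuasicoherent]
    [hN : N.IsQuasicoherent] {f : M ⟶ N} {U : X.Opens} (hU : IsAffineOpen U)
    (h : Function.Injective (f.app U)) {W : X.Opens} (hW : W ≤ U) :
    Function.Injective (f.app W) := by
  rw [isQuasicoherent_iff_isLocalizingAt] at hM hN
  rw [injective_iff_map_eq_zero] at h ⊢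
  intro s hs
  refine res_ext _ fun x hx ↦ ?_
  obtain ⟨r, hr, hxr⟩ := hU.exists_basicOpen_le ⟨x, hx⟩ (hW hx)
  refine ⟨_, hr, hxr, ?_⟩
  obtain ⟨n, t, ht⟩ := (hM U hU r).exists_res_eq (M.res hr s)
  -- The image of the lift `t` vanishes on `D(r)`, so a power of `r` kills it; injectivity over `U`
  -- then kills `r ^ k • t`.
  obtain ⟨k, hk⟩ := (hN U hU r).exists_smul_eq_zero (f.app U t) (by
    rw [← app_res, ht, Hom.app_smul, app_res, hs, res_zero, smul_zero])
  have h0 : r ^ k • t = 0 := h _ (by rw [Hom.app_smul, hk])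
  rw [res_zero, ← (isUnit_res_basicOpen r n).smul_eq_zero, ← ht,
    ← (isUnit_res_basicOpen r k).smul_eq_zero, ← res_smul, h0, res_zero]

/-- `N` is the direct image of its restriction to `U`. -/
def IsExtendedFrom (N : X.Modules) (U : X.Opens) : Prop :=
  ∀ W, Function.Bijective (N.res (inf_le_left : W ⊓ U ≤ W))

lemma IsExtendedFrom.pushforward {Y : Scheme.{u}} (π : Y ⟶ X) {N : Y.Modules} {U : X.Opens}
    (h : N.IsExtendedFrom (π ⁻¹ᵁ U)) : ((Modules.pushforward π).obj N).IsExtendedFrom U :=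
  fun W ↦ h (π ⁻¹ᵁ W)

lemma bijective_res_of_eq (N : X.Modules) {U V : X.Opens} (h : V ≤ U) (e : V = U) :
    Function.Bijective (N.res h) := by
  subst e
  have : N.res h = id := funext (N.res_self h)
  rw [this]
  exact Function.bijective_id

lemma isExtendedFrom_pushforward_of_preimage_eq_top {Y : Scheme.{u}} (j : Y ⟶ X) (N : Y.Modules)
    (U : X.Opens) (hU : j ⁻¹ᵁ U = ⊤) : ((Modules.pushforward j).obj N).IsExtendedFrom U :=
  fun W ↦ N.bijective_res_of_eq _ (by
    change j ⁻¹ᵁ W ⊓ j ⁻¹ᵁ U = _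
    rw [hU, inf_top_eq])

lemma IsExtendedFrom.bijective_res {N : X.Modules} {U : X.Opens} (h : N.IsExtendedFrom U)
    {V W : X.Opens} (hV : V ≤ W) (e : V = W ⊓ U) : Function.Bijective (N.res hV) := by
  subst e
  exact h W

lemma app_eq_of_isExtendedFrom {M N : X.Modules} {U : X.Opens} (hN : N.IsExtendedFrom U)
    {f g : M ⟶ N} (h : ∀ {W : X.Opens} (_ : W ≤ U) (s : Γ(M, W)), f.app W s = g.app W s) :
    f = g := by
  ext W s
  apply (hN W).1
  rw [← app_res, ← app_res]
  exact h inf_le_right _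

/-- Morphisms from a quasi-coherent module to a module extended from an affine open `U` are
determined on sections over `U`. -/
lemma hom_ext_of_isExtendedFrom {M N : X.Modules} [M.IsQuasicoherent] {U : X.Opens}
    (hU : IsAffineOpen U) (hN : N.IsExtendedFrom U) {f g : M ⟶ N}
    (h : ∀ s, f.app U s = g.app U s) : f = g :=
  app_eq_of_isExtendedFrom hN fun hW s ↦ app_eq_of_app_eq hU h hW s

/-- Over `W` the unit is restriction of sections from `W` to its intersection with the image of `j`.
-/
lemma isIso_restrictAdjunction_unit_app {Y : Scheme.{u}} (j : Y ⟶ X) [IsOpenImmersion j]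
    {N : X.Modules} (hN : N.IsExtendedFrom (j ''ᵁ ⊤)) :
    IsIso ((restrictAdjunction j).unit.app N) := by
  rw [Hom.isIso_iff_isIso_app]
  intro W
  rw [ConcreteCategory.isIso_iff_bijective, restrictAdjunction_unit_app_app]
  exact hN.bijective_res _ (by
    rw [j.image_preimage_eq_opensRange_inf, inf_comm, j.image_top_eq_opensRange])

/-- Transpose `φ` along the adjunction of tilde and global sections, and precompose with the inverse
of the counit at `M`. Only the source has to be quasi-coherent. -/
lemma exists_moduleSpecΓFunctor_map_eq {R : CommRingCat.{u}} {M N : (Spec R).Modules}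
    [M.IsQuasicoherent] (φ : moduleSpecΓFunctor.obj M ⟶ moduleSpecΓFunctor.obj N) :
    ∃ g : M ⟶ N, moduleSpecΓFunctor.map g = φ := by
  have h : IsIso (tilde.adjunction.counit.app M) :=
    inferInstanceAs (IsIso M.fromTildeΓ)
  refine ⟨inv (tilde.adjunction.counit.app M) ≫ (tilde.adjunction.homEquiv _ _).symm φ, ?_⟩
  rw [Functor.map_comp, Functor.map_inv, IsIso.inv_comp_eq]
  rw [← cancel_epi (tilde.adjunction.unit.app (moduleSpecΓFunctor.obj M)),
    tilde.adjunction.right_triangle_components_assoc]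
  exact (tilde.adjunction.homEquiv_unit _ _ _).symm.trans (Equiv.apply_symm_apply _ _)

lemma exists_app_top_eq {R : CommRingCat.{u}} {M N : (Spec R).Modules}
    [M.IsQuasicoherent] (φ : Γ(M, ⊤) →ₗ[R] Γ(N, ⊤)) :
    ∃ g : M ⟶ N, ∀ s, g.app ⊤ s = φ s := by
  have key (A B : ModuleCat.{u} R) (ψ : A →ₗ[R] B) : ∃ ψ' : A ⟶ B, ∀ s, ψ'.hom s = ψ s :=
    ⟨ModuleCat.ofHom ψ, fun _ ↦ rfl⟩
  obtain ⟨φ', hφ'⟩ := key (moduleSpecΓFunctor.obj M) (moduleSpecΓFunctor.obj N) φ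
  obtain ⟨g, hg⟩ := exists_moduleSpecΓFunctor_map_eq φ'
  refine ⟨g, fun s ↦ ?_⟩
  refine Eq.trans ?_ (hφ' s)
  rw [← hg]
  rfl

/-- On `Spec R` the map `φ` comes from a morphism `g` of restrictions; `f` is the composite `M ⟶ j_*
j^* M ⟶ j_* j^* N ≅ N`, the last step because `N` is extended. -/
lemma exists_app_eq_of_isOpenImmersion {R : CommRingCat.{u}} {M N : X.Modules}
    [M.IsQuasicoherent] (j : Spec R ⟶ X) [IsOpenImmersion j] (hN : N.IsExtendedFrom (j ''ᵁ ⊤))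
    (φ : Γ(M, j ''ᵁ ⊤) →ₗ[Γ(X, j ''ᵁ ⊤)] Γ(N, j ''ᵁ ⊤)) :
    ∃ f : M ⟶ N, ∀ s, f.app (j ''ᵁ ⊤) s = φ s := by
  obtain ⟨g, hg⟩ := exists_app_top_eq (M := M.restrict j) (N := N.restrict j)
    { toFun := φ, map_add' := φ.map_add, map_smul' := fun r s ↦ φ.map_smul _ _ }
  have := isIso_restrictAdjunction_unit_app j hN
  refine ⟨(restrictAdjunction j).unit.app M ≫ (Modules.pushforward j).map g ≫
    inv ((restrictAdjunction j).unit.app N), fun s ↦ ?_⟩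
  set f := (restrictAdjunction j).unit.app M ≫ (Modules.pushforward j).map g ≫
    inv ((restrictAdjunction j).unit.app N) with hf
  have hf' : f ≫ (restrictAdjunction j).unit.app N =
      (restrictAdjunction j).unit.app M ≫ (Modules.pushforward j).map g := by
    simp [hf]
  have h1 : N.res (j.image_preimage_le _) (f.app (j ''ᵁ ⊤) s) =
      g.app (j ⁻¹ᵁ (j ''ᵁ ⊤)) (M.res (j.image_preimage_le _) s) :=
    congr(Hom.app $hf' (j ''ᵁ ⊤) s)
  have h2 : g.app (j ⁻¹ᵁ (j ''ᵁ ⊤)) (M.res (j.image_preimage_le _) s) =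
      N.res (j.image_preimage_le _) (g.app ⊤ s) :=
    app_res g (le_top : j ⁻¹ᵁ (j ''ᵁ ⊤) ≤ ⊤) s
  refine (N.bijective_res_of_eq (j.image_preimage_le _) ?_).1
    (h1.trans (h2.trans (congrArg _ (hg s))))
  rw [j.preimage_image_eq]

/-- A linear map between the sections over an affine open `U` extends to a morphism from a
quasi-coherent module to a module extended from `U`. -/
lemma exists_app_eq {M N : X.Modules} [M.IsQuasicoherent] {U : X.Opens} (hU : IsAffineOpen U)
    (hN : N.IsExtendedFrom U) (φ : Γ(M, U) →ₗ[Γ(X, U)] Γ(N, U)) :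
    ∃ f : M ⟶ N, ∀ s, f.app U s = φ s := by
  obtain ⟨R, j, hj, rfl⟩ : ∃ (R : CommRingCat.{u}) (j : Spec R ⟶ X) (_ : IsOpenImmersion j),
      j ''ᵁ ⊤ = U := ⟨_, hU.fromSpec, inferInstance, by simp⟩
  exact exists_app_eq_of_isOpenImmersion j hN φ

end AlgebraicGeometry.Scheme.Modules

/-! ### Functions on the affine line over an affine open. -/

namespace AlgebraicGeometry.Scheme

open TopologicalSpace

variable {X : Scheme.{u}}

lemma bijective_eval₂_C_X (R : Type u) [CommRing R] :
    Function.Bijective (Polynomial.eval₂RingHom (MvPolynomial.C (σ := PUnit.{u + 1}) (R := R))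
      (MvPolynomial.X PUnit.unit)) := by
  have : ((MvPolynomial.uniqueAlgEquiv R PUnit.{u + 1}).symm : Polynomial R →+* _) =
      Polynomial.eval₂RingHom (MvPolynomial.C (σ := PUnit.{u + 1}) (R := R))
      (MvPolynomial.X PUnit.unit) := by
    ext <;> simp
  rw [← this]
  exact (MvPolynomial.uniqueAlgEquiv R PUnit.{u + 1}).symm.bijective

lemma bijective_appLE_of_isOpenImmersion {Y : Scheme.{u}} (j : Y ⟶ X) [IsOpenImmersion j]
    {V : X.Opens} (hV : j ''ᵁ ⊤ = V) (h : ⊤ ≤ j ⁻¹ᵁ V) : Function.Bijective (j.appLE V ⊤ h) := by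
  subst hV
  rw [← ConcreteCategory.isIso_iff_bijective, ← Hom.appIso_hom']
  infer_instance

/-- The sections `Γ(X, U)[T] ⟶ Γ(𝔸¹, π⁻¹ U)`. -/
noncomputable def affineLine.ofPolynomial (U : X.Opens) :
    Polynomial Γ(X, U) →+* Γ(X.affineLine, (X.affineLine ↘ X) ⁻¹ᵁ U) :=
  Polynomial.eval₂RingHom ((X.affineLine ↘ X).app U).hom
    (X.affineLine.res le_top (affineLine.T X))

/-- `π ⁻¹ᵁ U` is the image of an open immersion from the spectrum of `MvPolynomial PUnit Γ(X, U)`.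
Pullback `ψ` along it is bijective on sections and, by checking constants and `T`, carries
`ofPolynomial` to the standard isomorphism. -/
lemma affineLine.bijective_ofPolynomial {U : X.Opens} (hU : IsAffineOpen U) :
    Function.Bijective (affineLine.ofPolynomial U) := by
  let n := PUnit.{u + 1}
  let R : CommRingCat.{u} := Γ(X, U)
  let S : CommRingCat.{u} := .of (MvPolynomial n R)
  have := (MorphismProperty.of_isPullback (P := @IsOpenImmersion)
    (AffineSpace.isPullback_map (n := n) hU.fromSpec).flip inferInstance)
  let i : Spec S ⟶ X.affineLine := (AffineSpace.SpecIso n R).inv ≫ AffineSpace.map n hU.fromSpec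
  have hi : i ≫ (X.affineLine ↘ X) = Spec.map (CommRingCat.ofHom MvPolynomial.C) ≫ hU.fromSpec :=
    (Category.assoc _ _ _).trans ((congrArg _ (AffineSpace.map_over _)).trans
      (AffineSpace.SpecIso_inv_over_assoc _ _))
  have hT : i.appTop (affineLine.T X) = (ΓSpecIso S).inv (MvPolynomial.X PUnit.unit) := by
    rw [Hom.comp_appTop, CommRingCat.comp_apply]
    exact (congrArg _ (AffineSpace.map_appTop_coord _ _)).trans
      (AffineSpace.SpecIso_inv_appTop_coord _ _)
  have hV : i ''ᵁ ⊤ = (X.affineLine ↘ X) ⁻¹ᵁ U := by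
    have h1 : i.opensRange = (AffineSpace.map n hU.fromSpec).opensRange :=
      Hom.opensRange_comp_of_isIso _ _
    rw [Hom.image_top_eq_opensRange, h1]
    refine Opens.ext ?_
    have := image_preimage_eq_of_isPullback
      (AffineSpace.isPullback_map (n := n) hU.fromSpec).flip .univ
    rw [Set.preimage_univ, Set.image_univ, Set.image_univ] at this
    refine this.trans ?_
    rw [hU.range_fromSpec]
    rfl
  have hV' : ⊤ ≤ i ⁻¹ᵁ ((X.affineLine ↘ X) ⁻¹ᵁ U) := by
    rw [← hV, i.preimage_image_eq]
  let ψ := i.appLE ((X.affineLine ↘ X) ⁻¹ᵁ U) ⊤ hV' ≫ (ΓSpecIso S).hom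
  have hψ : Function.Bijective ψ :=
    (ConcreteCategory.bijective_of_isIso (ΓSpecIso S).hom).comp
      (bijective_appLE_of_isOpenImmersion i hV hV')
  have hT' : ψ (X.affineLine.res le_top (affineLine.T X)) = MvPolynomial.X PUnit.unit := by
    have h1 : X.affineLine.presheaf.map (homOfLE le_top).op ≫
        i.appLE ((X.affineLine ↘ X) ⁻¹ᵁ U) ⊤ hV' = i.appTop := by
      exact (Hom.map_appLE _ _ _).trans (Hom.appLE_eq_app _)
    have h2 := congr($h1 (affineLine.T X)).trans hT
    refine (congrArg (ΓSpecIso S).hom h2).trans ?_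
    exact congr($((ΓSpecIso S).inv_hom_id) _)
  have hC : (X.affineLine ↘ X).app U ≫ ψ = CommRingCat.ofHom MvPolynomial.C := by
    have h1 : (X.affineLine ↘ X).app U ≫ i.appLE ((X.affineLine ↘ X) ⁻¹ᵁ U) ⊤ hV' =
        (ΓSpecIso R).inv ≫ (Spec.map (CommRingCat.ofHom MvPolynomial.C)).appTop := by
      have h2 : (⊤ : (Spec S).Opens) ≤ (i ≫ (X.affineLine ↘ X)) ⁻¹ᵁ U := hV'
      rw [Hom.app_eq_appLE, Hom.appLE_comp_appLE]
      -- The proof `h2` depends on the morphism, so rewriting along `hi` needs a variable target.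
      have h3 : ∀ (k : Spec S ⟶ X) (hk : i ≫ (X.affineLine ↘ X) = k),
        (i ≫ (X.affineLine ↘ X)).appLE U ⊤ h2 = k.appLE U ⊤ (hk ▸ h2) := by
        rintro _ rfl; rfl
      rw [h3 _ hi, Hom.comp_appLE, hU.fromSpec_app_self, Category.assoc]
      exact congrArg _ ((Hom.map_appLE _ _ _).trans (Hom.appLE_eq_app _))
    rw [← Category.assoc, h1, Category.assoc, ΓSpecIso_naturality, Iso.inv_hom_id_assoc]
  have : ψ.hom.comp (affineLine.ofPolynomial U) =
      Polynomial.eval₂RingHom MvPolynomial.C (MvPolynomial.X PUnit.unit) := by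
    refine Polynomial.ringHom_ext' ?_ ?_
    · refine RingHom.ext fun r ↦ ?_
      simp only [affineLine.ofPolynomial, RingHom.comp_apply, Polynomial.coe_eval₂RingHom, Polynomial.eval₂_C]
      exact congr($hC r)
    · simp only [affineLine.ofPolynomial, RingHom.comp_apply, Polynomial.coe_eval₂RingHom, Polynomial.eval₂_X]
      exact hT'
  have h := bijective_eval₂_C_X R
  rw [← this] at h
  exact (Function.Bijective.of_comp_iff' hψ _).1 h

end AlgebraicGeometry.Scheme

/-! ### A criterion for a left exact functor to be an equivalence. -/

namespace CategoryTheory.Functor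

attribute [local instance] Abelian.hasFiniteBiproducts

section

variable {A : Type*} [Category A] {B : Type*} [Category B]

/-- `E` induces a bijection between morphisms to `G` and morphisms to `E.obj G`. -/
def IsFullyFaithfulAt (E : A ⥤ B) (G : A) : Prop :=
  ∀ M, Function.Bijective (E.map : (M ⟶ G) → (E.obj M ⟶ E.obj G))

variable [Abelian A] [Abelian B] {E : A ⥤ B} [E.Additive]

/-- An additive `E` preserves the relation `∑ π ≫ ι = 𝟙`, so a morphism into `E.obj (⨁ G)` is
determined by its components. -/
lemma IsFullyFaithfulAt.biproduct {ι : Type w} [Finite ι] {G : ι → A}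
    (hG : ∀ i, E.IsFullyFaithfulAt (G i)) : E.IsFullyFaithfulAt (⨁ G) := by
  have := Fintype.ofFinite ι
  refine fun M ↦ ⟨fun f g h ↦ biproduct.hom_ext _ _ fun i ↦ (hG i M).1 ?_, fun h ↦ ?_⟩
  · rw [E.map_comp, E.map_comp]
    exact congrArg (· ≫ _) h
  · choose f hf using fun i ↦ (hG i M).2 (h ≫ E.map (biproduct.π G i))
    refine ⟨biproduct.lift f, ?_⟩
    have total : ∑ i, biproduct.π G i ≫ biproduct.ι G i = 𝟙 (⨁ G) := by
      refine biproduct.hom_ext _ _ fun j ↦ ?_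
      rw [Preadditive.sum_comp, Finset.sum_eq_single j]
      · simp
      · intro i _ hi
        rw [Category.assoc, biproduct.ι_π_ne _ hi, comp_zero]
      · simp
    have key (k : E.obj M ⟶ E.obj (⨁ G)) :
        k = ∑ i, (k ≫ E.map (biproduct.π G i)) ≫ E.map (biproduct.ι G i) := by
      simp_rw [Category.assoc, ← E.map_comp]
      rw [← Preadditive.comp_sum, ← E.map_sum, total, E.map_id, Category.comp_id]
    rw [key h, key (E.map _)]
    refine Finset.sum_congr rfl fun i _ ↦ ?_
    rw [← E.map_comp, biproduct.lift_π, hf]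

/-- `E.map i` is still a monomorphism. A preimage of `h ≫ E.map i` is killed by `d`, because it is
so after `E` and `E` is injective on maps to `G₁`; hence it factors through `N`. -/
lemma IsFullyFaithfulAt.of_kernel {N G₀ G₁ : A} (h₀ : E.IsFullyFaithfulAt G₀)
    (h₁ : E.IsFullyFaithfulAt G₁) [PreservesFiniteLimits E] (i : N ⟶ G₀) (d : G₀ ⟶ G₁)
    (w : i ≫ d = 0) (hi : IsLimit (KernelFork.ofι i w)) : E.IsFullyFaithfulAt N := by
  have : Mono i := Fork.IsLimit.mono hi
  refine fun M ↦ ⟨fun f g h ↦ ?_, fun h ↦ ?_⟩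
  · rw [← cancel_mono i]
    apply (h₀ M).1
    rw [E.map_comp, E.map_comp]
    exact congrArg (· ≫ _) h
  · obtain ⟨f, hf⟩ := (h₀ M).2 (h ≫ E.map i)
    have hfd : f ≫ d = 0 := (h₁ M).1 (by
      rw [E.map_comp, hf, Category.assoc, ← E.map_comp, w, E.map_zero, E.map_zero, comp_zero])
    obtain ⟨l, hl⟩ := KernelFork.IsLimit.lift' hi f hfd
    refine ⟨l, ?_⟩
    rw [← cancel_mono (E.map i), ← hf, ← E.map_comp]
    exact congrArg E.map hl

/-- A left exact functor between abelian categories is an equivalence if it is fully faithful at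
sufficiently many objects, in the sense that every object of either category embeds in
one of them. -/
lemma isEquivalence_of_exists_mono [PreservesFiniteLimits E]
    (hA : ∀ N : A, ∃ (G : A) (f : N ⟶ G), E.IsFullyFaithfulAt G ∧ Mono f)
    (hB : ∀ Y : B, ∃ (G : A) (f : Y ⟶ E.obj G), E.IsFullyFaithfulAt G ∧ Mono f) :
    E.IsEquivalence := by
  have h (N : A) : E.IsFullyFaithfulAt N := by
    obtain ⟨G₀, i, h₀, _⟩ := hA N
    -- Embedding the cokernel of `i` exhibits `N` as the kernel of a morphism `G₀ ⟶ G₁`.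
    obtain ⟨G₁, j, h₁, _⟩ := hA (cokernel i)
    refine h₀.of_kernel h₁ i (cokernel.π i ≫ j) (by simp) ?_
    exact isKernelCompMono (Abelian.monoIsKernelOfCokernel _ (cokernelIsCokernel i)) j rfl
  have : E.Faithful := ⟨fun h' ↦ (h _ _).1 h'⟩
  have : E.Full := ⟨fun h' ↦ (h _ _).2 h'⟩
  have : E.EssSurj := ⟨fun Y ↦ by
    obtain ⟨G₀, i, h₀, _⟩ := hB Y
    obtain ⟨G₁, j, h₁, _⟩ := hB (cokernel i)
    -- Fullness is already known, so the copresentation of `Y` lifts to `A`, and `E` preserves the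
    -- kernel of the lift.
    let d := E.preimage (cokernel.π i ≫ j)
    have hd : i ≫ E.map d = 0 := by simp [d]
    have l : IsLimit (KernelFork.ofι i hd) :=
      isKernelCompMono (Abelian.monoIsKernelOfCokernel _ (cokernelIsCokernel i)) j
        (E.map_preimage _)
    exact ⟨Limits.kernel d, ⟨(PreservesKernel.iso E d).trans
      ((kernelIsKernel (E.map d)).conePointUniqueUpToIso l)⟩⟩⟩
  exact { }

/-- A finite jointly monic family is a monomorphism into a biproduct; in `B` the target is `E` of
the biproduct formed in `A`. -/
lemma isEquivalence_of_exists_jointly_mono [PreservesFiniteLimits E]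
    (hA : ∀ N : A, ∃ (ι : Type w) (_ : Finite ι) (G : ι → A) (f : ∀ i, N ⟶ G i),
      (∀ i, E.IsFullyFaithfulAt (G i)) ∧ ∀ (Z : A) (g : Z ⟶ N), (∀ i, g ≫ f i = 0) → g = 0)
    (hB : ∀ Y : B, ∃ (ι : Type w) (_ : Finite ι) (G : ι → A) (f : ∀ i, Y ⟶ E.obj (G i)),
      (∀ i, E.IsFullyFaithfulAt (G i)) ∧ ∀ (Z : B) (g : Z ⟶ Y), (∀ i, g ≫ f i = 0) → g = 0) :
    E.IsEquivalence := by
  refine E.isEquivalence_of_exists_mono (fun N ↦ ?_) fun Y ↦ ?_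
  · obtain ⟨ι, _, G, f, hG, hf⟩ := hA N
    refine ⟨⨁ G, biproduct.lift f, .biproduct hG, Preadditive.mono_of_cancel_zero _ fun g hg ↦
      hf _ g fun i ↦ ?_⟩
    rw [← biproduct.lift_π f i, ← Category.assoc, hg, zero_comp]
  · obtain ⟨ι, _, G, f, hG, hf⟩ := hB Y
    have := Fintype.ofFinite ι
    refine ⟨⨁ G, ∑ i, f i ≫ E.map (biproduct.ι G i), .biproduct hG,
      Preadditive.mono_of_cancel_zero _ fun g hg ↦ hf _ g fun i ↦ ?_⟩
    have h : (∑ i, f i ≫ E.map (biproduct.ι G i)) ≫ E.map (biproduct.π G i) = f i := by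
      rw [Preadditive.sum_comp, Finset.sum_eq_single i]
      · rw [Category.assoc, ← E.map_comp, biproduct.ι_π_self, E.map_id, Category.comp_id]
      · intro j _ hj
        rw [Category.assoc, ← E.map_comp, biproduct.ι_π_ne _ hj, E.map_zero, comp_zero]
      · simp
    rw [← h, ← Category.assoc, hg, zero_comp]

end

end CategoryTheory.Functor

/-! ### Loop diagrams, and full faithfulness of `e` at extended modules. -/

namespace Loop

/-- A natural transformation between diagrams of shape `Loop`, from a morphism that commutes with
the generating endomorphisms. -/
def natTransMk {C : Type*} [Category C] {F G : Loop.{u} ⥤ C}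
    (f : F.obj PUnit.unit ⟶ G.obj PUnit.unit)
    (h : F.map (X := PUnit.unit) (Y := PUnit.unit) ⟨1⟩ ≫ f =
      f ≫ G.map (X := PUnit.unit) (Y := PUnit.unit) ⟨1⟩) : F ⟶ G where
  app _ := f
  naturality := by
    rintro ⟨⟩ ⟨⟩ ⟨n⟩
    induction n with
    | zero =>
      exact (congrArg (· ≫ f) (F.map_id _)).trans
        ((Category.id_comp f).trans ((Category.comp_id f).symm.trans
          (congrArg (f ≫ ·) (G.map_id _).symm)))
    | succ n ih =>
      have hF : F.map (X := PUnit.unit) (Y := PUnit.unit) ⟨n + 1⟩ = F.map ⟨n⟩ ≫ F.map ⟨1⟩ :=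
        F.map_comp (X := (PUnit.unit : Loop)) (Y := PUnit.unit) (Z := PUnit.unit) ⟨n⟩ ⟨1⟩
      have hG : G.map (X := PUnit.unit) (Y := PUnit.unit) ⟨n + 1⟩ = G.map ⟨n⟩ ≫ G.map ⟨1⟩ :=
        G.map_comp (X := (PUnit.unit : Loop)) (Y := PUnit.unit) (Z := PUnit.unit) ⟨n⟩ ⟨1⟩
      rw [hF, hG, Category.assoc, h, ← Category.assoc, ih, Category.assoc]

end Loop

namespace AlgebraicGeometry.Scheme

open TopologicalSpace

noncomputable section

variable (X : Scheme.{u})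

/-- The functor `M ↦ (π_* M, T)` on quasi-coherent modules. -/
def qcohPushforwardLoop : X.affineLine.Qcoh ⥤ (Loop.{u} ⥤ X.Qcoh) where
  obj M := X.isQcoh.lift (X.pushforwardLoop.obj M.obj) fun _ ↦
    haveI : M.obj.IsQuasicoherent := M.property
    Modules.isQuasicoherent_pushforward _ _
  map f :=
    { app l := ObjectProperty.homMk ((X.pushforwardLoop.map f.hom).app l)
      naturality _ _ n := by
        ext : 1
        exact (X.pushforwardLoop.map f.hom).naturality n }

lemma qcohPushforwardLoop_comp_ι :
    X.qcohPushforwardLoop ⋙ (Functor.whiskeringRight Loop.{u} X.Qcoh X.Modules).obj X.isQcoh.ι =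
      X.affineLine.isQcoh.ι ⋙ X.pushforwardLoop := rfl

instance : X.qcohPushforwardLoop.Additive where
  map_add {M N f g} := by
    ext l : 3
    exact (Modules.pushforward (X.affineLine ↘ X)).map_add

/-- Quasi-coherent kernels are kernels of modules, `π_*` is a right adjoint, and the full inclusion
reflects limits; for an additive functor kernels suffice. -/
instance : PreservesFiniteLimits X.qcohPushforwardLoop := by
  have (M N : X.affineLine.Qcoh) (f : M ⟶ N) :
      PreservesLimit (parallelPair f 0) X.qcohPushforwardLoop := by
    refine preservesLimit_of_evaluation _ _ fun l ↦ ?_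
    have : PreservesLimit (parallelPair f 0)
        (X.affineLine.isQcoh.ι ⋙ Modules.pushforward (X.affineLine ↘ X)) := by
      have : PreservesLimitsOfSize.{0, 0} (Modules.pushforward (X.affineLine ↘ X)) :=
        (Modules.pullbackPushforwardAdjunction _).rightAdjoint_preservesLimits
      have : PreservesLimit (parallelPair f 0) X.affineLine.isQcoh.ι :=
        X.affineLine.isQcoh.preservesKernels_ι f
      exact comp_preservesLimit _ _
    have : PreservesLimit (parallelPair f 0)
        ((X.qcohPushforwardLoop ⋙ (CategoryTheory.evaluation _ _).obj l) ⋙ X.isQcoh.ι) := this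
    exact preservesLimit_of_reflects_of_preserves _ X.isQcoh.ι
  exact Functor.preservesFiniteLimits_of_preservesKernels _

variable {X}

/-- The coordinate function on the preimage of `U`. -/
abbrev affineLine.coordOn (U : X.Opens) : Γ(X.affineLine, (X.affineLine ↘ X) ⁻¹ᵁ U) :=
  X.affineLine.res le_top (affineLine.T X)

/-- Induction on polynomials: every function on `π ⁻¹ᵁ U` is a polynomial in `T` over `Γ(X, U)`. -/
lemma affineLine.map_smul {U : X.Opens} (hU : IsAffineOpen U) {A B : Type*} [AddCommGroup A]
    [AddCommGroup B] [Module Γ(X.affineLine, (X.affineLine ↘ X) ⁻¹ᵁ U) A]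
    [Module Γ(X.affineLine, (X.affineLine ↘ X) ⁻¹ᵁ U) B] (φ : A →+ B)
    (h : ∀ r s, φ ((X.affineLine ↘ X).app U r • s) = (X.affineLine ↘ X).app U r • φ s)
    (hT : ∀ s, φ (affineLine.coordOn U • s) =
      affineLine.coordOn U • φ s)
    (a : Γ(X.affineLine, (X.affineLine ↘ X) ⁻¹ᵁ U)) (s : A) : φ (a • s) = a • φ s := by
  obtain ⟨p, rfl⟩ := (affineLine.bijective_ofPolynomial hU).2 a
  induction p using Polynomial.induction_on generalizing s with
  | C r => simpa [affineLine.ofPolynomial] using h r s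
  | add p q hp hq => rw [map_add, add_smul, add_smul, φ.map_add, hp, hq]
  | monomial n r ih =>
    rw [pow_succ, ← mul_assoc, map_mul, mul_smul, mul_smul, ih]
    simp [affineLine.ofPolynomial, hT]

/-- Both Hom sets consist of additive maps of sections over `π ⁻¹ᵁ U`. Linearity over the functions
there amounts to linearity over `Γ(X, U)` together with commutation with `T`. -/
lemma isFullyFaithfulAt_of_isExtendedFrom (N : X.affineLine.Qcoh) {U : X.Opens}
    (hU : IsAffineOpen U) (hN : N.obj.IsExtendedFrom ((X.affineLine ↘ X) ⁻¹ᵁ U)) :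
    X.qcohPushforwardLoop.IsFullyFaithfulAt N := by
  intro M
  have : M.obj.IsQuasicoherent := M.property
  have hM : ((Modules.pushforward (X.affineLine ↘ X)).obj M.obj).IsQuasicoherent :=
    Modules.isQuasicoherent_pushforward _ _
  have hV : IsAffineOpen ((X.affineLine ↘ X) ⁻¹ᵁ U) := hU.preimage _
  refine ⟨fun f g h ↦ ?_, fun g ↦ ?_⟩
  · have h' : (Modules.pushforward (X.affineLine ↘ X)).map f.hom =
        (Modules.pushforward (X.affineLine ↘ X)).map g.hom :=
      congr(($h).app PUnit.unit |>.hom)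
    ext : 1
    exact Modules.hom_ext_of_isExtendedFrom hV hN fun s ↦ congr(Modules.Hom.app $h' U s)
  · let g₀ : (Modules.pushforward (X.affineLine ↘ X)).obj M.obj ⟶
        (Modules.pushforward (X.affineLine ↘ X)).obj N.obj := (g.app PUnit.unit).hom
    let φ : Γ(M.obj, (X.affineLine ↘ X) ⁻¹ᵁ U) →+ Γ(N.obj, (X.affineLine ↘ X) ⁻¹ᵁ U) :=
      (g₀.app U).hom
    have hφT (s) : φ (affineLine.coordOn U • s) =
        affineLine.coordOn U • φ s := by
      have h : (Modules.pushforward (X.affineLine ↘ X)).map (M.obj.mulBy (affineLine.T X ^ 1)) ≫ g₀ =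
          g₀ ≫ (Modules.pushforward (X.affineLine ↘ X)).map (N.obj.mulBy (affineLine.T X ^ 1)) :=
        congr($(g.naturality (X := PUnit.unit) (Y := PUnit.unit) ⟨1⟩).hom)
      rw [pow_one] at h
      exact congr(Modules.Hom.app $h U s)
    obtain ⟨f, hf⟩ := Modules.exists_app_eq (M := M.obj) (N := N.obj) hV hN
      { toFun := φ
        map_add' := φ.map_add
        map_smul' := affineLine.map_smul hU φ (fun r s ↦ g₀.app_smul r s) hφT }
    refine ⟨ObjectProperty.homMk f, ?_⟩
    ext l : 3
    exact Modules.hom_ext_of_isExtendedFrom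
      (M := (Modules.pushforward (X.affineLine ↘ X)).obj M.obj) hU hN.pushforward hf

end

end AlgebraicGeometry.Scheme

/-! ### Embeddings into extended modules over a separated scheme, and the equivalence. -/

namespace AlgebraicGeometry.Scheme

open TopologicalSpace

/-- Cancel the separated structure morphism of `X` from an affine composite. Affineness is what
makes direct images from `U` quasi-coherent. -/
lemma isAffineHom_fromSpec (X : Scheme.{u}) [X.IsSeparated] {U : X.Opens} (hU : IsAffineOpen U) :
    IsAffineHom hU.fromSpec := by
  have : IsAffineHom (hU.fromSpec ≫ terminal.from X) := inferInstance
  exact .of_comp hU.fromSpec (terminal.from X)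

instance (X : Scheme.{u}) [X.IsSeparated] : X.affineLine.IsSeparated := by
  have h : IsSeparated ((X.affineLine ↘ X) ≫ terminal.from X) := inferInstance
  rw [terminal.comp_from] at h
  exact ⟨h⟩

lemma exists_finite_affine_cover (X : Scheme.{u}) [CompactSpace X] :
    ∃ (ι : Type u) (_ : Finite ι) (U : ι → X.Opens), (∀ i, IsAffineOpen (U i)) ∧ ∀ x, ∃ i, x ∈ U i := by
  choose U hU hx _ using fun x : X ↦ exists_isAffineOpen_mem_and_subset (x := x) (U := ⊤) trivial
  obtain ⟨t, ht⟩ := CompactSpace.elim_nhds_subcover (fun x ↦ (U x : Set X)) fun x ↦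
    (U x).isOpen.mem_nhds (hx x)
  refine ⟨t, inferInstance, fun x ↦ U x, fun x ↦ hU x, fun x ↦ ?_⟩
  obtain ⟨y, hy, h⟩ := Set.mem_iUnion₂.mp (ht.ge (Set.mem_univ x))
  exact ⟨⟨y, hy⟩, h⟩

namespace Modules

variable {X : Scheme.{u}}

/-- Vanishing is local on the cover, so morphisms `f i` injective over `U i` are jointly monic. -/
lemma eq_zero_of_comp_eq_zero {ι : Type*} {U : ι → X.Opens} (hU : ∀ x, ∃ i, x ∈ U i)
    {M N : X.Modules} {G : ι → X.Modules} (f : ∀ i, N ⟶ G i)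
    (hf : ∀ i {W : X.Opens}, W ≤ U i → Function.Injective ((f i).app W)) (g : M ⟶ N)
    (h : ∀ i, g ≫ f i = 0) : g = 0 := by
  ext W s
  refine res_ext _ fun x hx ↦ ?_
  obtain ⟨i, hi⟩ := hU x
  refine ⟨W ⊓ U i, inf_le_left, ⟨hx, hi⟩, hf i inf_le_right ?_⟩
  have h0 (t : Γ(M, W)) : (f i).app W (g.app W t) = 0 := congr(Hom.app $(h i) W t)
  rw [app_res, app_res, h0]
  exact congrArg _ (map_zero ((f i).app W).hom).symm

/-- Over a separated scheme, every module over the sections on an affine open `U` embeds in the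
sections of a quasi-coherent module that is extended from `U`. -/
lemma exists_isExtendedFrom_injective [X.IsSeparated] {U : X.Opens} (hU : IsAffineOpen U)
    (P : ModuleCat.{u} Γ(X, U)) :
    ∃ N : X.Modules, N.IsQuasicoherent ∧ N.IsExtendedFrom U ∧
      ∃ θ : P →ₗ[Γ(X, U)] Γ(N, U), Function.Injective θ := by
  have := X.isAffineHom_fromSpec hU
  refine ⟨(Modules.pushforward hU.fromSpec).obj (tilde P), isQuasicoherent_pushforward _ _,
    isExtendedFrom_pushforward_of_preimage_eq_top _ _ _ hU.fromSpec_preimage_self, ?_⟩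
  let θ : P →ₗ[Γ(X, U)] Γ(tilde P, hU.fromSpec ⁻¹ᵁ U) := (tilde.toOpen P (hU.fromSpec ⁻¹ᵁ U)).hom
  refine ⟨{ toFun := θ, map_add' := θ.map_add, map_smul' := fun r s ↦ ?_ }, ?_⟩
  · refine (θ.map_smul r s).trans ?_
    rw [smul_Spec_def]
    change _ = hU.fromSpec.app U r • θ s
    rw [hU.fromSpec_app_self]
    rfl
  -- The preimage of `U` equals `⊤` only propositionally, hence the variable `W`.
  · have h (W : (Spec Γ(X, U)).Opens) (hW : W = ⊤) : Function.Injective (tilde.toOpen P W).hom := by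
      subst hW
      exact (ConcreteCategory.bijective_of_isIso (tilde.toOpen P ⊤)).1
    exact h _ hU.fromSpec_preimage_self

/-- Over a separated scheme, every quasi-coherent module embeds over an affine open `U` in a
quasi-coherent module that is extended from `U`. -/
lemma exists_hom_isExtendedFrom [X.IsSeparated] (M : X.Modules) [M.IsQuasicoherent] {U : X.Opens}
    (hU : IsAffineOpen U) :
    ∃ (N : X.Modules) (f : M ⟶ N), N.IsQuasicoherent ∧ N.IsExtendedFrom U ∧
      ∀ {W : X.Opens}, W ≤ U → Function.Injective (f.app W) := by
  obtain ⟨N, hN, hN', θ, hθ⟩ := exists_isExtendedFrom_injective hU (.of _ Γ(M, U))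
  obtain ⟨f, hf⟩ := exists_app_eq hU hN' θ
  refine ⟨N, f, hN, hN', app_injective_of_app_injective hU ?_⟩
  rwa [show (f.app U : Γ(M, U) → Γ(N, U)) = θ from funext hf]

end Modules

open Modules

noncomputable section

variable (X : Scheme.{u}) [X.IsSeparated]

/-- Letting `T` act by `t` makes `Γ(M, U)` a module over `Γ(X, U)[T]`, that is, over the functions
on `π ⁻¹ᵁ U`. It embeds in the sections of an extended `N`, and the embedding extends to `f` because
`π_* N` is extended from `U`; compatibility with `T` is then tested over `U`. -/
lemma exists_hom_pushforward {U : X.Opens} (hU : IsAffineOpen U) (M : X.Modules)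
    [M.IsQuasicoherent] (t : M ⟶ M) :
    ∃ (N : X.affineLine.Modules) (f : M ⟶ (Modules.pushforward (X.affineLine ↘ X)).obj N),
      N.IsQuasicoherent ∧ N.IsExtendedFrom ((X.affineLine ↘ X) ⁻¹ᵁ U) ∧
      t ≫ f = f ≫ (Modules.pushforward (X.affineLine ↘ X)).map (N.mulBy (affineLine.T X)) ∧
      ∀ {W : X.Opens}, W ≤ U → Function.Injective (f.app W) := by
  let e := RingEquiv.ofBijective _ (affineLine.bijective_ofPolynomial hU)
  let τ : Module.End Γ(X, U) Γ(M, U) :=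
    { toFun := t.app U, map_add' := map_add (t.app U).hom, map_smul' := t.app_smul }
  let ρ : Γ(X.affineLine, (X.affineLine ↘ X) ⁻¹ᵁ U) →+* Module.End Γ(X, U) Γ(M, U) :=
    (Polynomial.aeval τ).toRingHom.comp e.symm.toRingHom
  have hρC (r : Γ(X, U)) : ρ ((X.affineLine ↘ X).app U r) = algebraMap _ _ r := by
    have : e (Polynomial.C r) = (X.affineLine ↘ X).app U r := by
      simp [e, affineLine.ofPolynomial]
    simp [ρ, ← this]
  have hρT : ρ (affineLine.coordOn U) = τ := by
    have : e Polynomial.X = affineLine.coordOn U := by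
      simp [e, affineLine.ofPolynomial]
    simp [ρ, ← this]
  let mod : Module Γ(X.affineLine, (X.affineLine ↘ X) ⁻¹ᵁ U) Γ(M, U) := Module.compHom _ ρ
  obtain ⟨N, hN, hN', θ, hθ⟩ := exists_isExtendedFrom_injective (hU.preimage (X.affineLine ↘ X))
    (.of _ Γ(M, U))
  have hq : ((Modules.pushforward (X.affineLine ↘ X)).obj N).IsQuasicoherent :=
    isQuasicoherent_pushforward _ _
  let φ : Γ(M, U) →ₗ[Γ(X, U)] Γ((Modules.pushforward (X.affineLine ↘ X)).obj N, U) :=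
    { toFun := θ
      map_add' := θ.map_add
      map_smul' := fun r s ↦ by
        refine Eq.trans ?_ (θ.map_smul ((X.affineLine ↘ X).app U r) s)
        exact congrArg θ congr($(hρC r) s).symm }
  obtain ⟨f, hf⟩ := exists_app_eq hU hN'.pushforward φ
  refine ⟨N, f, hN, hN', hom_ext_of_isExtendedFrom hU hN'.pushforward fun s ↦ ?_,
    app_injective_of_app_injective hU ?_⟩
  · change f.app U (t.app U s) = affineLine.coordOn U • (show Γ(N, _) from f.app U s)
    rw [hf, hf]
    refine Eq.trans ?_ (θ.map_smul (affineLine.coordOn U) s)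
    exact congrArg θ congr($hρT s).symm
  · rwa [show (f.app U : Γ(M, U) → _) = θ from funext hf]

/-- Quasi-compactness makes the cover finite, as the biproducts in the criterion require. The same
cover serves both categories, through its preimage on the affine line. -/
instance [CompactSpace X] : X.qcohPushforwardLoop.IsEquivalence := by
  obtain ⟨ι, _, U, hU, hU'⟩ := X.exists_finite_affine_cover
  refine Functor.isEquivalence_of_exists_jointly_mono (fun N ↦ ?_) fun Y ↦ ?_
  · have : N.obj.IsQuasicoherent := N.property
    choose G f hG hG' hf using fun i ↦
      exists_hom_isExtendedFrom N.obj ((hU i).preimage (X.affineLine ↘ X))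
    refine ⟨ι, ‹_›, fun i ↦ ⟨G i, hG i⟩, fun i ↦ ObjectProperty.homMk (f i),
      fun i ↦ isFullyFaithfulAt_of_isExtendedFrom _ (hU i) (hG' i), fun Z g hg ↦ ?_⟩
    ext : 1
    exact eq_zero_of_comp_eq_zero (fun x ↦ hU' ((X.affineLine ↘ X) x)) f (fun i ↦ hf i) g.hom
      fun i ↦ congr(($(hg i)).hom)
  · have : (Y.obj PUnit.unit).obj.IsQuasicoherent := (Y.obj PUnit.unit).property
    choose G f hG hG' hT hf using fun i ↦ X.exists_hom_pushforward (hU i)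
      (Y.obj PUnit.unit).obj (Y.map (X := PUnit.unit) (Y := PUnit.unit) ⟨1⟩).hom
    refine ⟨ι, ‹_›, fun i ↦ ⟨G i, hG i⟩, fun i ↦ Loop.natTransMk (ObjectProperty.homMk (f i)) ?_,
      fun i ↦ isFullyFaithfulAt_of_isExtendedFrom _ (hU i) (hG' i), fun Z g hg ↦ ?_⟩
    · ext : 1
      refine (hT i).trans ?_
      change f i ≫ _ = f i ≫ (Modules.pushforward (X.affineLine ↘ X)).map
        ((G i).mulBy (affineLine.T X ^ 1))
      rw [pow_one]
    · ext l : 3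
      exact eq_zero_of_comp_eq_zero hU' f (fun i ↦ hf i) (g.app l).hom
        fun i ↦ congr((($(hg i)).app l).hom)

end

end AlgebraicGeometry.Scheme

theorem mainTheorem4 (X : AlgebraicGeometry.Scheme.{u}) [CompactSpace X] [X.IsSeparated] :
    ∃ e : X.affineLine.Qcoh ≌ (Loop.{u} ⥤ X.Qcoh),
      e.functor ⋙ (Functor.whiskeringRight Loop.{u} X.Qcoh X.Modules).obj X.isQcoh.ι =
        X.affineLine.isQcoh.ι ⋙ X.pushforwardLoop ∧
      ∃ Φ : Prederivator.StrongEquivalence X.affineLine.derivator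
          (X.derivator.shift (Cat.of Loop.{u})),
        ∀ I : Cat.{u, u},
          Prederivator.Derived.Q (I ⥤ X.affineLine.Qcoh) ⋙ Φ.functor I =
            (Prederivator.diagrams e.functor I).mapHomologicalComplex (ComplexShape.up ℤ) ⋙
              Prederivator.Derived.Q (Loop.{u} × I ⥤ X.Qcoh) :=
  ⟨X.qcohPushforwardLoop.asEquivalence, X.qcohPushforwardLoop_comp_ι,
    Prederivator.strongEquivalence X.qcohPushforwardLoop.asEquivalence,
    Prederivator.Q_strongEquivalence_functor X.qcohPushforwardLoop.asEquivalence⟩
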